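/- Let $n\ge 2$ and $m$ be natural numbers. Suppose that for all traceless symmetric real $n\times n$ matrices $B_1,\dots,B_m$ $$\sum_{\alpha,\beta=1}^m\|[B_\alpha,B_\beta]\|^2\le\Big(\sum_{\alpha=1}^m\|B_\alpha\|^2\Big)^2,$$ where $[A,B]=AB-BA$ and $\|A\|^2=\operatorname{tr}(A^tA)$. Then for every real $c$, every smooth Riemannian manifold $\widetilde M^{n+m}(c)$ of dimension $n+m$ with constant sectional curvature $c$ (a real space form), every smooth $n$-dimensional Riemannian manifold $M^n$ and every smooth isometric immersion $f:M^n\to\widetilde M^{n+m}(c)$, at every point $p$ of $M^n$ $$\rho\le\|H\|^2-\rho^\perp+c .$$ Here, for any orthonormal basis $e_1,\dots,e_n$ of $T_pM$ and any orthonormal basis $u_1,\dots,u_m$ of the normal space $T_p^\perp M$, $$\rho=\frac{2}{n(n-1)}\sum_{i<j}\langle R(e_i,e_j)e_j,e_i\rangle,\qquad H=\frac1n\sum_{i=1}^n h(e_i,e_i),\qquad \rho^\perp=\frac{2}{n(n-1)}\sqrt{\sum_{i<j}\sum_{\alpha<\beta}\langle R^\perp(e_i,e_j)u_\alpha,u_\beta\rangle^2}$$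 are the normalized scalar curvature of $M$, the mean curvature vector and the normalized normal scalar curvature at $p$; $R$ is the Riemann–Christoffel curvature tensor of $M$, $h$ the second fundamental form of $f$ and $R^\perp$ the curvature tensor of the normal connection. -/

import Mathlib

open Set
open scoped Manifold ContDiff Matrix

noncomputable section

namespace Submanifold

/-! ### Local Riemannian geometry in coordinates

A Riemannian metric on an open part of a finite-dimensional space `E` is described by its
coefficients `G : E → E →L[ℝ] E →L[ℝ] ℝ`. Vector fields with constant coefficients are the
coordinate fields; they commute with each other. -/

section Local

variable {E E' : Type*} [NormedAddCommGroup E] [NormedSpace ℝ E]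
  [NormedAddCommGroup E'] [NormedSpace ℝ E']

/-- The Christoffel symbols (of the second kind) `Γ_x(v, w) ∈ E` of the metric `G`: the vector
with `2 G_x(Γ_x(v, w), z) = (∂_v G)(w, z) + (∂_w G)(v, z) - (∂_z G)(v, w)` for all `z`. Here
`(G x).inverse` is the index-raising map, inverse to `v ↦ G_x(v, ·)`. -/
def christoffel (G : E → E →L[ℝ] E →L[ℝ] ℝ) (x v w : E) : E :=
  (G x).inverse ((1 / 2 : ℝ) •
    (fderiv ℝ G x v w + fderiv ℝ G x w v - ((fderiv ℝ G x).flip v).flip w))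

/-- The Levi-Civita covariant derivative `∇_v W` at `x` of the vector field `W`. -/
def covDeriv (G : E → E →L[ℝ] E →L[ℝ] ℝ) (W : E → E) (v x : E) : E :=
  fderiv ℝ W x v + christoffel G x v (W x)

/-- The Riemann-Christoffel curvature tensor
`R(u, v)w = ∇_u ∇_v w - ∇_v ∇_u w - ∇_[u, v] w` at `x`, evaluated on coordinate fields (so that
the bracket term vanishes). -/
def curvature (G : E → E →L[ℝ] E →L[ℝ] ℝ) (x u v w : E) : E :=
  covDeriv G (fun y => covDeriv G (fun _ => w) v y) u x -
    covDeriv G (fun y => covDeriv G (fun _ => w) u y) v x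

/-- The covariant derivative `∇̃_v V` at `x` of a vector field `V` along the map `F : E → E'`,
for the Levi-Civita connection of the metric `G'` on `E'`. -/
def covDerivAlong (G' : E' → E' →L[ℝ] E' →L[ℝ] ℝ) (F : E → E') (V : E → E') (v x : E) : E' :=
  fderiv ℝ V x v + christoffel G' (F x) (fderiv ℝ F x v) (V x)

/-- The second fundamental form, by the formula of Gauss: `h(v, w) = ∇̃_v dF(w) - dF(∇_v w)`. -/
def secondForm (G : E → E →L[ℝ] E →L[ℝ] ℝ) (G' : E' → E' →L[ℝ] E' →L[ℝ] ℝ) (F : E → E')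
    (x v w : E) : E' :=
  covDerivAlong G' F (fun y => fderiv ℝ F y w) v x -
    fderiv ℝ F x (covDeriv G (fun _ => w) v x)

/-- The component normal to the submanifold of `ξ ∈ E'` at `F x`, for an isometric immersion `F`
of `(E, G)` into `(E', G')`. The vector that is subtracted is `dF(z)`, where `z` is determined by
`G_x(z, v) = G'_{F x}(ξ, dF(v))` for all `v`. -/
def normalPart (G : E → E →L[ℝ] E →L[ℝ] ℝ) (G' : E' → E' →L[ℝ] E' →L[ℝ] ℝ) (F : E → E')
    (x : E) (ξ : E') : E' :=
  ξ - fderiv ℝ F x ((G x).inverse ((G' (F x) ξ).comp (fderiv ℝ F x)))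

/-- The normal connection: `∇^⊥_v N` is the normal component of `∇̃_v N`. -/
def normalCovDeriv (G : E → E →L[ℝ] E →L[ℝ] ℝ) (G' : E' → E' →L[ℝ] E' →L[ℝ] ℝ) (F : E → E')
    (N : E → E') (v x : E) : E' :=
  normalPart G G' F x (covDerivAlong G' F N v x)

/-- The curvature tensor of the normal connection,
`R^⊥(u, v)ξ = ∇^⊥_u ∇^⊥_v N - ∇^⊥_v ∇^⊥_u N - ∇^⊥_[u, v] N` at `x` for a normal vector `ξ`. It is
evaluated on coordinate fields `u`, `v` and on the normal vector field `N` that is the normal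
component of the field with constant coefficients `ξ`, so that `N x = ξ`; by tensoriality every
other extension of `ξ` to a normal field gives the same value. -/
def normalCurvature (G : E → E →L[ℝ] E →L[ℝ] ℝ) (G' : E' → E' →L[ℝ] E' →L[ℝ] ℝ) (F : E → E')
    (x u v : E) (ξ : E') : E' :=
  normalCovDeriv G G' F
      (fun y => normalCovDeriv G G' F (fun z => normalPart G G' F z ξ) v y) u x -
    normalCovDeriv G G' F
      (fun y => normalCovDeriv G G' F (fun z => normalPart G G' F z ξ) u y) v x

end Local

/-! ### Riemannian manifolds -/

/-- A smooth Riemannian metric on the `n`-dimensional smooth manifold `M`. -/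
abbrev RiemMetric (n : ℕ) (M : Type*) [TopologicalSpace M]
    [ChartedSpace (EuclideanSpace ℝ (Fin n)) M] [IsManifold (𝓡 n) ∞ M] :=
  Bundle.ContMDiffRiemannianMetric (𝓡 n) ∞ (EuclideanSpace ℝ (Fin n))
    (fun p : M => TangentSpace (𝓡 n) p)

section Manifold

variable {n k : ℕ}
  {M : Type*} [TopologicalSpace M] [ChartedSpace (EuclideanSpace ℝ (Fin n)) M]
  [IsManifold (𝓡 n) ∞ M]
  {N : Type*} [TopologicalSpace N] [ChartedSpace (EuclideanSpace ℝ (Fin k)) N]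
  [IsManifold (𝓡 k) ∞ N]

/-- The coefficients of the metric `g` in the preferred chart `φ` at `p`: at the point `x` of the
target of `φ`, `G_x(v, w) = g(d(φ⁻¹)_x v, d(φ⁻¹)_x w)`. -/
def metricInChart (g : RiemMetric n M) (p : M) (x : EuclideanSpace ℝ (Fin n)) :
    EuclideanSpace ℝ (Fin n) →L[ℝ] EuclideanSpace ℝ (Fin n) →L[ℝ] ℝ :=
  let D : EuclideanSpace ℝ (Fin n) →L[ℝ] TangentSpace (𝓡 n) ((extChartAt (𝓡 n) p).symm x) :=
    mfderiv 𝓘(ℝ, EuclideanSpace ℝ (Fin n)) (𝓡 n) (extChartAt (𝓡 n) p).symm x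
  (ContinuousLinearMap.precomp ℝ D).comp
    ((g.inner ((extChartAt (𝓡 n) p).symm x)).comp D)

variable (n) in
/-- The coordinates of a tangent vector at `p` in the preferred chart `φ` at `p`: the differential
`dφ_p`, a linear isomorphism. -/
def toChart (p : M) : TangentSpace (𝓡 n) p →L[ℝ] EuclideanSpace ℝ (Fin n) :=
  mfderiv (𝓡 n) 𝓘(ℝ, EuclideanSpace ℝ (Fin n)) (extChartAt (𝓡 n) p) p

variable (n) in
/-- The tangent vector at `p` with given coordinates in the preferred chart at `p`. -/
def ofChart (p : M) : EuclideanSpace ℝ (Fin n) →L[ℝ] TangentSpace (𝓡 n) p :=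
  (toChart n p).inverse

/-- The Riemann-Christoffel curvature tensor `R(u, v)w` at `p` of the Riemannian manifold `(M, g)`,
computed in the preferred chart at `p`. -/
def riemann (g : RiemMetric n M) (p : M) (u v w : TangentSpace (𝓡 n) p) : TangentSpace (𝓡 n) p :=
  ofChart n p (curvature (metricInChart g p) (extChartAt (𝓡 n) p p)
    (toChart n p u) (toChart n p v) (toChart n p w))

/-- The sectional curvature of the plane spanned by the linearly independent vectors `v`, `w`. -/
def sectionalCurvature (g : RiemMetric n M) (p : M) (v w : TangentSpace (𝓡 n) p) : ℝ :=
  g.inner p (riemann g p v w w) v /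
    (g.inner p v v * g.inner p w w - g.inner p v w ^ 2)

/-- `(M, g)` is a real space form of constant sectional curvature `c`. -/
def IsRealSpaceForm (g : RiemMetric n M) (c : ℝ) : Prop :=
  ∀ (p : M) (v w : TangentSpace (𝓡 n) p), LinearIndependent ℝ ![v, w] →
    sectionalCurvature g p v w = c

/-- `e` is an orthonormal basis of the tangent space `T_pM` (`n` orthonormal vectors in a space of
dimension `n`). -/
def IsTangentFrame (g : RiemMetric n M) (p : M) (e : Fin n → TangentSpace (𝓡 n) p) : Prop :=
  ∀ i j, g.inner p (e i) (e j) = if i = j then 1 else 0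

/-- The normalized scalar curvature at `p`, computed with the orthonormal basis `e` of `T_pM`. -/
def normScalarCurvature (g : RiemMetric n M) (p : M) (e : Fin n → TangentSpace (𝓡 n) p) : ℝ :=
  2 / ((n : ℝ) * ((n : ℝ) - 1)) *
    ∑ i, ∑ j ∈ Finset.Ioi i, g.inner p (riemann g p (e i) (e j) (e j)) (e i)

/-! ### Submanifolds -/

/-- `f` is an isometric immersion of `(M, g)` into `(N, g')`. (It is an immersion because `g` is
positive definite.) -/
structure IsIsometricImmersion (g : RiemMetric n M) (g' : RiemMetric k N) (f : M → N) : Prop where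
  contMDiff : ContMDiff (𝓡 n) (𝓡 k) ∞ f
  isometric : ∀ (p : M) (v w : TangentSpace (𝓡 n) p),
    g'.inner (f p) (mfderiv (𝓡 n) (𝓡 k) f p v) (mfderiv (𝓡 n) (𝓡 k) f p w) = g.inner p v w

/-- The second fundamental form `h(v, w) ∈ T_{f p}N` at `p` of the isometric immersion `f`,
computed in the preferred charts at `p` and at `f p`. -/
def secondFundamentalForm (g : RiemMetric n M) (g' : RiemMetric k N) (f : M → N) (p : M)
    (v w : TangentSpace (𝓡 n) p) : TangentSpace (𝓡 k) (f p) :=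
  ofChart k (f p) (secondForm (metricInChart g p) (metricInChart g' (f p))
    (writtenInExtChartAt (𝓡 n) (𝓡 k) p f) (extChartAt (𝓡 n) p p)
    (toChart n p v) (toChart n p w))

/-- The mean curvature vector `H = (1/n) ∑ h(e_i, e_i)` at `p`, computed with the orthonormal basis
`e` of `T_pM`. -/
def meanCurvature (g : RiemMetric n M) (g' : RiemMetric k N) (f : M → N) (p : M)
    (e : Fin n → TangentSpace (𝓡 n) p) : TangentSpace (𝓡 k) (f p) :=
  (1 / (n : ℝ)) • ∑ i, secondFundamentalForm g g' f p (e i) (e i)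

/-- The curvature tensor `R^⊥(v, w)ξ` at `p` of the normal connection of the isometric immersion
`f`, for a normal vector `ξ`, computed in the preferred charts at `p` and at `f p`. -/
def normalRiemann (g : RiemMetric n M) (g' : RiemMetric k N) (f : M → N) (p : M)
    (v w : TangentSpace (𝓡 n) p) (ξ : TangentSpace (𝓡 k) (f p)) : TangentSpace (𝓡 k) (f p) :=
  ofChart k (f p) (normalCurvature (metricInChart g p) (metricInChart g' (f p))
    (writtenInExtChartAt (𝓡 n) (𝓡 k) p f) (extChartAt (𝓡 n) p p)
    (toChart n p v) (toChart n p w) (toChart k (f p) ξ))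

variable (n) in
/-- `u` is an orthonormal system of `m` vectors normal to the submanifold at `p`; in codimension
`m` this is an orthonormal basis of the normal space `T_p^⊥M`. -/
def IsNormalFrame {m : ℕ} (g' : RiemMetric k N) (f : M → N) (p : M)
    (u : Fin m → TangentSpace (𝓡 k) (f p)) : Prop :=
  (∀ α β, g'.inner (f p) (u α) (u β) = if α = β then 1 else 0) ∧
    ∀ (α : Fin m) (v : TangentSpace (𝓡 n) p),
      g'.inner (f p) (u α) (mfderiv (𝓡 n) (𝓡 k) f p v) = 0

/-- The normalized normal scalar curvature at `p`, computed with the orthonormal bases `e` of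
`T_pM` and `u` of `T_p^⊥M`. -/
def normNormalScalarCurvature {m : ℕ} (g : RiemMetric n M) (g' : RiemMetric k N) (f : M → N)
    (p : M) (e : Fin n → TangentSpace (𝓡 n) p) (u : Fin m → TangentSpace (𝓡 k) (f p)) : ℝ :=
  2 / ((n : ℝ) * ((n : ℝ) - 1)) *
    √(∑ i, ∑ j ∈ Finset.Ioi i, ∑ α, ∑ β ∈ Finset.Ioi α,
      g'.inner (f p) (normalRiemann g g' f p (e i) (e j) (u α)) (u β) ^ 2)

end Manifold

/-- The squared norm `‖A‖² = tr(Aᵗ A)` of an `n × n` matrix. -/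
def matNormSq {n : ℕ} (A : Matrix (Fin n) (Fin n) ℝ) : ℝ := (Aᵀ * A).trace

end Submanifold

end

noncomputable section

set_option maxSynthPendingDepth 3
set_option linter.unusedSectionVars false

namespace Submanifold

/-! ### Levi-Civita connection and curvature of a metric on an open set. -/

section

variable {E E' : Type*} [NormedAddCommGroup E] [NormedSpace ℝ E]
  [NormedAddCommGroup E'] [NormedSpace ℝ E']

/-! At a fixed point everything is algebra in the shape operators, the symmetric matrices $A_\alpha$
with entries $\langle h(e_i,e_j),u_\alpha\rangle$. In constant curvature $c$ the Gauss equation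
gives $\langle R(e_i,e_j)e_j,e_i\rangle=c+\sum_\alpha(A^\alpha_{ii}A^\alpha_{jj}-(A^\alpha_{ij})^2)$
for $i\ne j$. In the Ricci equation the ambient curvature drops out, and $\langle
R^\perp(e_i,e_j)u_\alpha,u_\beta\rangle$ is, up to sign, the $(i,j)$ entry of $[A_\alpha,A_\beta]$.

Let $B_\alpha$ be the traceless part of $A_\alpha$ and $S=\sum_\alpha\|B_\alpha\|^2$. Passing to
$B_\alpha$ leaves the commutators unchanged, and summing the Gauss equation gives
$n(n-1)\rho=n(n-1)(\|H\|^2+c)-S$. The claim thus reads $n(n-1)\rho^\perp\le S$, which is the square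
root of the assumed matrix inequality. This part is `normal_scalar_inequality`.

The geometric work is to obtain the two equations from the coordinate definitions. Both come from
two properties of the connection along a map: it is metric (`fderiv_apply_apply`), and its curvature
is the pull-back of the ambient curvature (`covDerivAlong_comm`). They yield `gauss` and `ricci` for
an isometric immersion between open sets, and `isIsometryOn_writtenInExtChartAt` puts the given
immersion in that setting. `curvature_of_sectional` recovers the whole ambient curvature tensor from
its sectional curvatures. -/

/-- `G` is a smooth Riemannian metric on the open set `U`. -/
structure IsMetricOn (G : E → E →L[ℝ] E →L[ℝ] ℝ) (U : Set E) : Prop where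
  isOpen : IsOpen U
  contDiffOn : ContDiffOn ℝ ∞ G U
  symm : ∀ x ∈ U, ∀ v w, G x v w = G x w v
  pos : ∀ x ∈ U, ∀ v, v ≠ 0 → 0 < G x v v

/-- The Christoffel symbols of the first kind, as a bilinear map with values in the dual. -/
def christoffelLower (G : E → E →L[ℝ] E →L[ℝ] ℝ) (x : E) : E →L[ℝ] E →L[ℝ] E →L[ℝ] ℝ :=
  (1 / 2 : ℝ) • (fderiv ℝ G x + (fderiv ℝ G x).flip -
    ((ContinuousLinearMap.flipₗᵢ ℝ E E ℝ).toContinuousLinearEquiv :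
      (E →L[ℝ] E →L[ℝ] ℝ) →L[ℝ] (E →L[ℝ] E →L[ℝ] ℝ)).comp (fderiv ℝ G x).flip)

/-- The Christoffel symbols as a continuous bilinear map. -/
def christoffelMap (G : E → E →L[ℝ] E →L[ℝ] ℝ) (x : E) : E →L[ℝ] E →L[ℝ] E :=
  (ContinuousLinearMap.compL ℝ E (E →L[ℝ] ℝ) E (G x).inverse).comp (christoffelLower G x)

lemma christoffelMap_apply (G : E → E →L[ℝ] E →L[ℝ] ℝ) (x v w : E) :
    christoffelMap G x v w = christoffel G x v w := by
  simp [christoffelMap, christoffelLower, christoffel]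

lemma covDerivAlong_eq (G' : E' → E' →L[ℝ] E' →L[ℝ] ℝ) (F : E → E') (V : E → E') (v x : E) :
    covDerivAlong G' F V v x =
      fderiv ℝ V x v + christoffelMap G' (F x) (fderiv ℝ F x v) (V x) := by
  rw [christoffelMap_apply]; rfl

/-- The intrinsic connection is the connection along the identity map, so facts proved along maps
apply to it as well. -/
lemma covDeriv_eq_covDerivAlong (G : E → E →L[ℝ] E →L[ℝ] ℝ) (W : E → E) (v x : E) :
    covDeriv G W v x = covDerivAlong G id W v x := by
  simp [covDeriv, covDerivAlong]

lemma minSmoothness_two_le_infty : minSmoothness ℝ 2 ≤ (∞ : WithTop ℕ∞) := by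
  rw [minSmoothness_of_isRCLikeNormedField]
  exact WithTop.coe_le_coe.2 (le_top (a := (2 : ℕ∞)))

namespace IsMetricOn

variable {G : E → E →L[ℝ] E →L[ℝ] ℝ} {U : Set E} {G' : E' → E' →L[ℝ] E' →L[ℝ] ℝ} {U' : Set E'}

lemma contDiffAt (hG : IsMetricOn G U) {x : E} (hx : x ∈ U) : ContDiffAt ℝ ∞ G x :=
  hG.contDiffOn.contDiffAt (hG.isOpen.mem_nhds hx)

lemma eq_of_forall (hG : IsMetricOn G U) {x : E} (hx : x ∈ U) {a b : E}
    (h : ∀ z, G x a z = G x b z) : a = b := by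
  by_contra hab
  have := hG.pos x hx (a - b) (sub_ne_zero.2 hab)
  simp [h] at this

lemma fderiv_symm (hG : IsMetricOn G U) {x : E} (hx : x ∈ U) (u v w : E) :
    fderiv ℝ G x u v w = fderiv ℝ G x u w v := by
  have hd : HasFDerivAt G (fderiv ℝ G x) x :=
    ((hG.contDiffAt hx).differentiableAt (by simp)).hasFDerivAt
  have key : ∀ a b : E, HasFDerivAt (fun y => G y a b)
      (((fderiv ℝ G x).flip a).flip b) x := by
    intro a b
    have := (hd.clm_apply (hasFDerivAt_const a x)).clm_apply (hasFDerivAt_const b x)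
    refine this.congr_fderiv ?_
    ext z; simp
  have h1 : (fun y => G y v w) =ᶠ[nhds x] fun y => G y w v := by
    filter_upwards [hG.isOpen.mem_nhds hx] with y hy using hG.symm y hy v w
  have h2 := ((key v w).congr_of_eventuallyEq h1.symm).unique (key w v)
  simpa using congrArg (fun A => A u) h2

section Finite

variable [FiniteDimensional ℝ E] [FiniteDimensional ℝ E']

/-- Positivity makes index lowering injective, and a finite-dimensional space and its dual have
equal dimension. Without invertibility `inverse` would be the default value `0` and the Christoffel
symbols would carry no meaning. -/
lemma isInvertible (hG : IsMetricOn G U) {x : E} (hx : x ∈ U) : (G x).IsInvertible := by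
  have hinj : Function.Injective (G x).toLinearMap := by
    intro a b hab
    exact hG.eq_of_forall hx fun z => congrArg (fun A : E →L[ℝ] ℝ => A z) hab
  have hfr : Module.finrank ℝ E = Module.finrank ℝ (E →L[ℝ] ℝ) := by
    rw [← (LinearMap.toContinuousLinearMap (𝕜 := ℝ) (E := E) (F' := ℝ)).finrank_eq]
    exact (Subspace.dual_finrank_eq (K := ℝ) (V := E)).symm
  exact ⟨(LinearEquiv.ofInjectiveOfFinrankEq (G x).toLinearMap hinj hfr).toContinuousLinearEquiv,
    by ext; rfl⟩

lemma apply_inverse (hG : IsMetricOn G U) {x : E} (hx : x ∈ U) (φ : E →L[ℝ] ℝ) :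
    G x ((G x).inverse φ) = φ :=
  (hG.isInvertible hx).self_apply_inverse φ

lemma contDiffOn_inverse (hG : IsMetricOn G U) :
    ContDiffOn ℝ ∞ (fun x => (G x).inverse) U := by
  intro x hx
  have : CompleteSpace E := FiniteDimensional.complete ℝ E
  obtain ⟨e, he⟩ := hG.isInvertible hx
  refine ContDiffAt.contDiffWithinAt ?_
  refine ContDiffAt.comp x (g := ContinuousLinearMap.inverse) ?_ (hG.contDiffAt hx)
  rw [← he]
  exact contDiffAt_map_inverse e

lemma contDiffOn_christoffelMap (hG : IsMetricOn G U) :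
    ContDiffOn ℝ ∞ (christoffelMap G) U := by
  have h1 : ContDiffOn ℝ ∞ (fderiv ℝ G) U := hG.contDiffOn.fderiv_of_isOpen hG.isOpen (by simp)
  have h2 : ContDiffOn ℝ ∞ (fun x => (fderiv ℝ G x).flip) U :=
    (ContinuousLinearMap.flipₗᵢ ℝ E E (E →L[ℝ] ℝ)).contDiff.comp_contDiffOn h1
  have h3 : ContDiffOn ℝ ∞ (christoffelLower G) U :=
    ((h1.add h2).sub (contDiffOn_const.clm_comp h2)).const_smul (1 / 2 : ℝ)
  exact ((ContinuousLinearMap.compL ℝ E (E →L[ℝ] ℝ) E).contDiff.comp_contDiffOn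
    hG.contDiffOn_inverse).clm_comp h3

lemma two_mul_christoffelMap (hG : IsMetricOn G U) {x : E} (hx : x ∈ U) (v w z : E) :
    2 * G x (christoffelMap G x v w) z =
      fderiv ℝ G x v w z + fderiv ℝ G x w v z - fderiv ℝ G x z v w := by
  rw [christoffelMap_apply, christoffel, hG.apply_inverse hx]
  simp

lemma christoffelMap_symm (hG : IsMetricOn G U) {x : E} (hx : x ∈ U) (v w : E) :
    christoffelMap G x v w = christoffelMap G x w v := by
  refine hG.eq_of_forall hx fun z => ?_
  have h1 := hG.two_mul_christoffelMap hx v w z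
  have h2 := hG.two_mul_christoffelMap hx w v z
  have h3 := hG.fderiv_symm hx z v w
  linarith

/-- The connection is metric: adding the defining formulas of the two Christoffel terms, all
derivatives of `G` cancel except the one in direction `u`. -/
lemma fderiv_eq_christoffelMap (hG : IsMetricOn G U) {x : E} (hx : x ∈ U) (u v w : E) :
    fderiv ℝ G x u v w = G x (christoffelMap G x u v) w + G x v (christoffelMap G x u w) := by
  have h1 := hG.two_mul_christoffelMap hx u v w
  have h2 := hG.two_mul_christoffelMap hx u w v
  rw [hG.symm x hx v]
  have h3 := hG.fderiv_symm hx u v w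
  have h4 := hG.fderiv_symm hx v u w
  have h5 := hG.fderiv_symm hx w u v
  linarith

/-- The covariant derivative along `F` of a smooth field is smooth. -/
lemma contDiffOn_covDerivAlong (hG' : IsMetricOn G' U') {F V : E → E'} (hU : IsOpen U)
    (hF : ContDiffOn ℝ ∞ F U) (hFU : MapsTo F U U') (hV : ContDiffOn ℝ ∞ V U) (v : E) :
    ContDiffOn ℝ ∞ (covDerivAlong G' F V v) U := by
  have h1 : ContDiffOn ℝ ∞ (fun y => fderiv ℝ V y v) U :=
    (hV.fderiv_of_isOpen hU (by simp)).clm_apply contDiffOn_const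
  have h2 : ContDiffOn ℝ ∞ (fun y => fderiv ℝ F y v) U :=
    (hF.fderiv_of_isOpen hU (by simp)).clm_apply contDiffOn_const
  have h3 := hG'.contDiffOn_christoffelMap.comp hF hFU
  refine (h1.add ((h3.clm_apply h2).clm_apply hV)).congr fun y _ => covDerivAlong_eq ..

/-- The connection along a map is metric. -/
lemma fderiv_apply_apply (hG' : IsMetricOn G' U') {F V W : E → E'} {x : E}
    (hF : DifferentiableAt ℝ F x) (hx : F x ∈ U') (hV : DifferentiableAt ℝ V x)
    (hW : DifferentiableAt ℝ W x) (u : E) :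
    fderiv ℝ (fun y => G' (F y) (V y) (W y)) x u =
      G' (F x) (covDerivAlong G' F V u x) (W x) + G' (F x) (V x) (covDerivAlong G' F W u x) := by
  have hd : HasFDerivAt G' (fderiv ℝ G' (F x)) (F x) :=
    ((hG'.contDiffAt hx).differentiableAt (by simp)).hasFDerivAt
  have h1 := (hd.comp x hF.hasFDerivAt).clm_apply hV.hasFDerivAt
  have h2 : fderiv ℝ (fun y => G' (F y) (V y) (W y)) x = _ := (h1.clm_apply hW.hasFDerivAt).fderiv
  rw [h2, covDerivAlong_eq, covDerivAlong_eq]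
  have h3 := hG'.fderiv_eq_christoffelMap hx (fderiv ℝ F x u) (V x) (W x)
  simp [h3]
  ring

/-- The curvature tensor in terms of Christoffel symbols. -/
lemma curvature_eq (hG : IsMetricOn G U) {x : E} (hx : x ∈ U) (u v w : E) :
    curvature G x u v w =
      fderiv ℝ (christoffelMap G) x u v w - fderiv ℝ (christoffelMap G) x v u w +
        (christoffelMap G x u (christoffelMap G x v w) -
          christoffelMap G x v (christoffelMap G x u w)) := by
  have hd : HasFDerivAt (christoffelMap G) (fderiv ℝ (christoffelMap G) x) x :=
    ((hG.contDiffOn_christoffelMap.contDiffAt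
      (hG.isOpen.mem_nhds hx)).differentiableAt (by simp)).hasFDerivAt
  have key : ∀ a b : E, fderiv ℝ (fun y => christoffelMap G y a b) x =
      (((fderiv ℝ (christoffelMap G) x).flip a).flip b) := by
    intro a b
    have := (hd.clm_apply (hasFDerivAt_const a x)).clm_apply (hasFDerivAt_const b x)
    rw [this.fderiv]
    ext z; simp
  simp only [curvature, covDeriv, ← christoffelMap_apply, fderiv_fun_const, Pi.zero_apply,
    _root_.zero_apply, zero_add, key, ContinuousLinearMap.flip_apply]
  abel

lemma fderiv_christoffelMap_symm (hG : IsMetricOn G U) {x : E} (hx : x ∈ U) (u v w : E) :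
    fderiv ℝ (christoffelMap G) x u v w = fderiv ℝ (christoffelMap G) x u w v := by
  have hd : HasFDerivAt (christoffelMap G) (fderiv ℝ (christoffelMap G) x) x :=
    ((hG.contDiffOn_christoffelMap.contDiffAt
      (hG.isOpen.mem_nhds hx)).differentiableAt (by simp)).hasFDerivAt
  have key : ∀ a b : E, HasFDerivAt (fun y => christoffelMap G y a b)
      (((fderiv ℝ (christoffelMap G) x).flip a).flip b) x := by
    intro a b
    have := (hd.clm_apply (hasFDerivAt_const a x)).clm_apply (hasFDerivAt_const b x)
    refine this.congr_fderiv ?_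
    ext z; simp
  have h1 : (fun y => christoffelMap G y v w) =ᶠ[nhds x] fun y => christoffelMap G y w v := by
    filter_upwards [hG.isOpen.mem_nhds hx] with y hy using hG.christoffelMap_symm hy v w
  have h2 := ((key v w).congr_of_eventuallyEq h1.symm).unique (key w v)
  simpa using congrArg (fun A => A u) h2

/-- Absence of torsion, together with its first derivative, makes the cyclic sum cancel in pairs. -/
lemma curvature_bianchi (hG : IsMetricOn G U) {x : E} (hx : x ∈ U) (u v w : E) :
    curvature G x u v w + curvature G x v w u + curvature G x w u v = 0 := by
  rw [hG.curvature_eq hx, hG.curvature_eq hx, hG.curvature_eq hx,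
    hG.fderiv_christoffelMap_symm hx u v w, hG.fderiv_christoffelMap_symm hx v w u,
    hG.fderiv_christoffelMap_symm hx w u v, hG.christoffelMap_symm hx v w,
    hG.christoffelMap_symm hx w u, hG.christoffelMap_symm hx u v]
  abel

/-- The curvature of the connection along `F` is the pull-back of the curvature. -/
lemma covDerivAlong_comm (hG' : IsMetricOn G' U') {F V : E → E'} (hU : IsOpen U)
    (hF : ContDiffOn ℝ ∞ F U) (hFU : MapsTo F U U') (hV : ContDiffOn ℝ ∞ V U) {x : E}
    (hx : x ∈ U) (u v : E) :
    covDerivAlong G' F (covDerivAlong G' F V v) u x -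
        covDerivAlong G' F (covDerivAlong G' F V u) v x =
      curvature G' (F x) (fderiv ℝ F x u) (fderiv ℝ F x v) (V x) := by
  have hn := hU.mem_nhds hx
  have hF' := hF.contDiffAt hn
  have hV' := hV.contDiffAt hn
  have hd : HasFDerivAt (christoffelMap G') (fderiv ℝ (christoffelMap G') (F x)) (F x) :=
    ((hG'.contDiffOn_christoffelMap.contDiffAt
      (hG'.isOpen.mem_nhds (hFU hx))).differentiableAt (by simp)).hasFDerivAt
  have hFd := (hF'.differentiableAt (by simp)).hasFDerivAt
  have hVd := (hV'.differentiableAt (by simp)).hasFDerivAt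
  have hF2 : HasFDerivAt (fderiv ℝ F) (fderiv ℝ (fderiv ℝ F) x) x :=
    ((hF'.fderiv_right (m := ∞) (by simp)).differentiableAt (by simp)).hasFDerivAt
  have hV2 : HasFDerivAt (fderiv ℝ V) (fderiv ℝ (fderiv ℝ V) x) x :=
    ((hV'.fderiv_right (m := ∞) (by simp)).differentiableAt (by simp)).hasFDerivAt
  have hFs : fderiv ℝ (fderiv ℝ F) x u v = fderiv ℝ (fderiv ℝ F) x v u :=
    (hF'.isSymmSndFDerivAt minSmoothness_two_le_infty).eq u v
  have hVs : fderiv ℝ (fderiv ℝ V) x u v = fderiv ℝ (fderiv ℝ V) x v u :=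
    (hV'.isSymmSndFDerivAt minSmoothness_two_le_infty).eq u v
  -- Antisymmetrising in `a`, `b` removes the second derivatives of `V` and `F`; what survives is
  -- the coordinate expression of the curvature.
  have key : ∀ a b : E, fderiv ℝ (covDerivAlong G' F V a) x b =
      fderiv ℝ (fderiv ℝ V) x b a +
        (fderiv ℝ (christoffelMap G') (F x) (fderiv ℝ F x b) (fderiv ℝ F x a) (V x) +
        christoffelMap G' (F x) (fderiv ℝ (fderiv ℝ F) x b a) (V x) +
        christoffelMap G' (F x) (fderiv ℝ F x a) (fderiv ℝ V x b)) := by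
    intro a b
    have := (hV2.clm_apply (hasFDerivAt_const a x)).add
      (((hd.comp x hFd).clm_apply (hF2.clm_apply (hasFDerivAt_const a x))).clm_apply hVd)
    have h2 : fderiv ℝ (covDerivAlong G' F V a) x = _ :=
      (this.congr_of_eventuallyEq (Filter.Eventually.of_forall fun y =>
        covDerivAlong_eq G' F V a y)).fderiv
    rw [h2]
    simp
    abel
  rw [covDerivAlong_eq G' F (covDerivAlong G' F V v),
    covDerivAlong_eq G' F (covDerivAlong G' F V u), key, key, covDerivAlong_eq, covDerivAlong_eq,
    hG'.curvature_eq (hFU hx), hFs, hVs, map_add, map_add]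
  abel

/-- The function `y ↦ G y w z` has a symmetric second derivative. Differentiating it twice with the
metric connection and antisymmetrising, the mixed products cancel and `⟨R(u,v)w, z⟩ + ⟨w, R(u,v)z⟩ =
0` remains. -/
lemma apply_curvature_skew (hG : IsMetricOn G U) {x : E} (hx : x ∈ U) (u v w z : E) :
    G x (curvature G x u v w) z = - G x (curvature G x u v z) w := by
  have hcd : ∀ a b : E, ContDiffOn ℝ ∞ (covDerivAlong G id (fun _ => a) b) U := fun a b =>
    hG.contDiffOn_covDerivAlong hG.isOpen contDiffOn_id (mapsTo_id U) contDiffOn_const b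
  have hdiff : ∀ a b : E, ∀ y ∈ U, DifferentiableAt ℝ (covDerivAlong G id (fun _ => a) b) y :=
    fun a b y hy => ((hcd a b).contDiffAt (hG.isOpen.mem_nhds hy)).differentiableAt (by simp)
  set g : E → ℝ := fun y => G y w z with hg
  have hgs : ContDiffAt ℝ ∞ g x :=
    ((hG.contDiffAt hx).clm_apply contDiffAt_const).clm_apply contDiffAt_const
  have h1 : ∀ a, ∀ y ∈ U, fderiv ℝ g y a =
      G y (covDerivAlong G id (fun _ => w) a y) z + G y w (covDerivAlong G id (fun _ => z) a y) :=
    fun a y hy => hG.fderiv_apply_apply (F := id) (V := fun _ => w) (W := fun _ => z)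
      differentiableAt_id hy (differentiableAt_const _) (differentiableAt_const _) a
  have hg2 : HasFDerivAt (fderiv ℝ g) (fderiv ℝ (fderiv ℝ g) x) x :=
    ((hgs.fderiv_right (m := ∞) (by simp)).differentiableAt (by simp)).hasFDerivAt
  have hGd : DifferentiableAt ℝ G x := (hG.contDiffAt hx).differentiableAt (by simp)
  have h2 : ∀ a b, fderiv ℝ (fderiv ℝ g) x b a =
      G x (covDerivAlong G id (covDerivAlong G id (fun _ => w) a) b x) z +
        G x (covDerivAlong G id (fun _ => w) a x) (covDerivAlong G id (fun _ => z) b x) +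
      (G x (covDerivAlong G id (fun _ => w) b x) (covDerivAlong G id (fun _ => z) a x) +
        G x w (covDerivAlong G id (covDerivAlong G id (fun _ => z) a) b x)) := by
    intro a b
    have e1 : fderiv ℝ (fderiv ℝ g) x b a = fderiv ℝ (fun y => fderiv ℝ g y a) x b := by
      rw [(hg2.clm_apply (hasFDerivAt_const a x)).fderiv]; simp
    have e2 : (fun y => fderiv ℝ g y a) =ᶠ[nhds x] fun y =>
        G y (covDerivAlong G id (fun _ => w) a y) z +
          G y w (covDerivAlong G id (fun _ => z) a y) := by
      filter_upwards [hG.isOpen.mem_nhds hx] with y hy using h1 a y hy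
    rw [e1, e2.fderiv_eq, fderiv_fun_add, _root_.add_apply]
    · have := hG.fderiv_apply_apply (F := id) differentiableAt_id hx (hdiff w a x hx)
        (differentiableAt_const z) b
      have h' := hG.fderiv_apply_apply (F := id) differentiableAt_id hx
        (differentiableAt_const w) (hdiff z a x hx) b
      simp only [id] at this h'
      rw [this, h']
    · exact (hGd.clm_apply (hdiff w a x hx)).clm_apply (differentiableAt_const z)
    · exact (hGd.clm_apply (differentiableAt_const w)).clm_apply (hdiff z a x hx)
  have hs : fderiv ℝ (fderiv ℝ g) x u v = fderiv ℝ (fderiv ℝ g) x v u :=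
    (hgs.isSymmSndFDerivAt minSmoothness_two_le_infty).eq u v
  rw [h2, h2] at hs
  have c1 := hG.covDerivAlong_comm (F := id) hG.isOpen contDiffOn_id (mapsTo_id U)
    (contDiffOn_const (c := w)) hx u v
  have c2 := hG.covDerivAlong_comm (F := id) hG.isOpen contDiffOn_id (mapsTo_id U)
    (contDiffOn_const (c := z)) hx u v
  simp only [fderiv_id, ContinuousLinearMap.id_apply, id] at c1 c2
  rw [← c1, ← c2, hG.symm x hx _ w]
  simp only [map_sub, _root_.sub_apply]
  linarith

end Finite

end IsMetricOn

end

/-! ### Isometric immersions: the equations of Gauss, Weingarten and Ricci. -/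

section

variable {E E' : Type*} [NormedAddCommGroup E] [NormedSpace ℝ E]
  [NormedAddCommGroup E'] [NormedSpace ℝ E']

/-- `F` is an isometric immersion of `(U, G)` into `(U', G')`. -/
structure IsIsometryOn (G : E → E →L[ℝ] E →L[ℝ] ℝ) (U : Set E)
    (G' : E' → E' →L[ℝ] E' →L[ℝ] ℝ) (U' : Set E') (F : E → E') : Prop where
  metric : IsMetricOn G U
  metric' : IsMetricOn G' U'
  contDiffOn : ContDiffOn ℝ ∞ F U
  mapsTo : MapsTo F U U'
  isometric : ∀ x ∈ U, ∀ v w, G' (F x) (fderiv ℝ F x v) (fderiv ℝ F x w) = G x v w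

namespace IsIsometryOn

variable {G : E → E →L[ℝ] E →L[ℝ] ℝ} {U : Set E} {G' : E' → E' →L[ℝ] E' →L[ℝ] ℝ} {U' : Set E'}
  {F : E → E'}

lemma mem_nhds (h : IsIsometryOn G U G' U' F) {x : E} (hx : x ∈ U) : U ∈ nhds x :=
  h.metric.isOpen.mem_nhds hx

lemma contDiffOn_fderiv (h : IsIsometryOn G U G' U' F) (w : E) :
    ContDiffOn ℝ ∞ (fun y => fderiv ℝ F y w) U :=
  (h.contDiffOn.fderiv_of_isOpen h.metric.isOpen (by simp)).clm_apply contDiffOn_const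

variable [FiniteDimensional ℝ E] [FiniteDimensional ℝ E']

lemma differentiableAt (h : IsIsometryOn G U G' U' F) {V : E → E'} (hV : ContDiffOn ℝ ∞ V U)
    {x : E} (hx : x ∈ U) : DifferentiableAt ℝ V x :=
  (hV.contDiffAt (h.mem_nhds hx)).differentiableAt (by simp)

lemma covDerivAlong_smooth (h : IsIsometryOn G U G' U' F) {V : E → E'}
    (hV : ContDiffOn ℝ ∞ V U) (v : E) : ContDiffOn ℝ ∞ (covDerivAlong G' F V v) U :=
  h.metric'.contDiffOn_covDerivAlong h.metric.isOpen h.contDiffOn h.mapsTo hV v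

lemma fderiv_inner (h : IsIsometryOn G U G' U' F) {V W : E → E'} (hV : ContDiffOn ℝ ∞ V U)
    (hW : ContDiffOn ℝ ∞ W U) {x : E} (hx : x ∈ U) (u : E) :
    fderiv ℝ (fun y => G' (F y) (V y) (W y)) x u =
      G' (F x) (covDerivAlong G' F V u x) (W x) + G' (F x) (V x) (covDerivAlong G' F W u x) :=
  h.metric'.fderiv_apply_apply (h.differentiableAt h.contDiffOn hx) (h.mapsTo hx)
    (h.differentiableAt hV hx) (h.differentiableAt hW hx) u

/-- Second derivatives of `F` commute and the ambient connection has no torsion; this is the source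
of the symmetry of the second fundamental form. -/
lemma covDerivAlong_fderiv_symm (h : IsIsometryOn G U G' U' F) {x : E} (hx : x ∈ U) (v w : E) :
    covDerivAlong G' F (fun y => fderiv ℝ F y w) v x =
      covDerivAlong G' F (fun y => fderiv ℝ F y v) w x := by
  have hF := h.contDiffOn.contDiffAt (h.mem_nhds hx)
  have hF2 : HasFDerivAt (fderiv ℝ F) (fderiv ℝ (fderiv ℝ F) x) x :=
    ((hF.fderiv_right (m := ∞) (by simp)).differentiableAt (by simp)).hasFDerivAt
  have hFs : fderiv ℝ (fderiv ℝ F) x v w = fderiv ℝ (fderiv ℝ F) x w v :=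
    (hF.isSymmSndFDerivAt minSmoothness_two_le_infty).eq v w
  rw [covDerivAlong_eq, covDerivAlong_eq, h.metric'.christoffelMap_symm (h.mapsTo hx),
    (hF2.clm_apply (hasFDerivAt_const w x)).fderiv, (hF2.clm_apply (hasFDerivAt_const v x)).fderiv]
  simp [hFs]

/-- The tangential part of the ambient derivative is the intrinsic derivative. -/
lemma inner_covDerivAlong_fderiv (h : IsIsometryOn G U G' U' F) {x : E} (hx : x ∈ U)
    (v w z : E) :
    G' (F x) (covDerivAlong G' F (fun y => fderiv ℝ F y w) v x) (fderiv ℝ F x z) =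
      G x (covDeriv G (fun _ => w) v x) z := by
  have hGd : HasFDerivAt G (fderiv ℝ G x) x :=
    ((h.metric.contDiffAt hx).differentiableAt (by simp)).hasFDerivAt
  have key : ∀ a b c : E, fderiv ℝ G x a b c =
      G' (F x) (covDerivAlong G' F (fun y => fderiv ℝ F y b) a x) (fderiv ℝ F x c) +
        G' (F x) (fderiv ℝ F x b) (covDerivAlong G' F (fun y => fderiv ℝ F y c) a x) := by
    intro a b c
    rw [← h.fderiv_inner (h.contDiffOn_fderiv b) (h.contDiffOn_fderiv c) hx]
    have e : (fun y => G' (F y) (fderiv ℝ F y b) (fderiv ℝ F y c)) =ᶠ[nhds x]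
        fun y => G y b c := by
      filter_upwards [h.mem_nhds hx] with y hy using h.isometric y hy b c
    rw [e.fderiv_eq,
      ((hGd.clm_apply (hasFDerivAt_const b x)).clm_apply (hasFDerivAt_const c x)).fderiv]
    simp
  have h0 : covDeriv G (fun _ => w) v x = christoffelMap G x v w := by
    simp [covDeriv, christoffelMap_apply]
  have h1 := h.metric.two_mul_christoffelMap hx v w z
  have hs := h.metric'.symm (F x) (h.mapsTo hx)
  -- Each derivative of `G` becomes two ambient terms; by symmetry four of the six cancel and the
  -- other two coincide.
  rw [key, key, key, h.covDerivAlong_fderiv_symm hx w v, h.covDerivAlong_fderiv_symm hx z v,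
    h.covDerivAlong_fderiv_symm hx z w, hs (fderiv ℝ F x w), hs (fderiv ℝ F x v)] at h1
  rw [h0]
  linarith

lemma covDerivAlong_fderiv_eq (v w x : E) :
    covDerivAlong G' F (fun y => fderiv ℝ F y w) v x =
      fderiv ℝ F x (covDeriv G (fun _ => w) v x) + secondForm G G' F x v w := by
  simp [secondForm]

/-- The second fundamental form is normal. -/
lemma inner_secondForm_fderiv (h : IsIsometryOn G U G' U' F) {x : E} (hx : x ∈ U) (v w z : E) :
    G' (F x) (secondForm G G' F x v w) (fderiv ℝ F x z) = 0 := by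
  rw [secondForm, map_sub, _root_.sub_apply, h.inner_covDerivAlong_fderiv hx,
    h.isometric x hx, sub_self]

lemma inner_fderiv_secondForm (h : IsIsometryOn G U G' U' F) {x : E} (hx : x ∈ U) (v w z : E) :
    G' (F x) (fderiv ℝ F x z) (secondForm G G' F x v w) = 0 := by
  rw [h.metric'.symm _ (h.mapsTo hx), h.inner_secondForm_fderiv hx]

lemma covDeriv_const_symm (h : IsIsometryOn G U G' U' F) {x : E} (hx : x ∈ U) (v w : E) :
    covDeriv G (fun _ => w) v x = covDeriv G (fun _ => v) w x := by
  simp [covDeriv, ← christoffelMap_apply, h.metric.christoffelMap_symm hx v w]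

lemma secondForm_symm (h : IsIsometryOn G U G' U' F) {x : E} (hx : x ∈ U) (v w : E) :
    secondForm G G' F x v w = secondForm G G' F x w v := by
  rw [secondForm, secondForm, h.covDerivAlong_fderiv_symm hx, h.covDeriv_const_symm hx]

/-- The equation of Gauss. -/
lemma gauss (h : IsIsometryOn G U G' U' F) {x : E} (hx : x ∈ U) (u v w z : E) :
    G x (curvature G x u v w) z =
      G' (F x) (curvature G' (F x) (fderiv ℝ F x u) (fderiv ℝ F x v) (fderiv ℝ F x w))
        (fderiv ℝ F x z) +
      (G' (F x) (secondForm G G' F x v w) (secondForm G G' F x u z) -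
        G' (F x) (secondForm G G' F x u w) (secondForm G G' F x v z)) := by
  have hW : ∀ a b, ContDiffOn ℝ ∞ (covDeriv G (fun _ => a) b) U := fun a b =>
    (h.metric.contDiffOn_covDerivAlong h.metric.isOpen contDiffOn_id (mapsTo_id U)
      (contDiffOn_const (c := a)) b).congr fun y _ => covDeriv_eq_covDerivAlong ..
  have hWd : ∀ a b, DifferentiableAt ℝ (covDeriv G (fun _ => a) b) x := fun a b =>
    ((hW a b).contDiffAt (h.mem_nhds hx)).differentiableAt (by simp)
  -- Differentiate `⟨∇̃_b dF(w), dF(z)⟩ = G(∇_b w, z)` in direction `a` by both metric connections.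
  -- The tangential products agree, so the only discrepancy is a product of second fundamental
  -- forms.
  have key : ∀ a b, G x (covDeriv G (covDeriv G (fun _ => w) b) a x) z =
      G' (F x) (covDerivAlong G' F (covDerivAlong G' F (fun y => fderiv ℝ F y w) b) a x)
        (fderiv ℝ F x z) + G' (F x) (secondForm G G' F x b w) (secondForm G G' F x a z) := by
    intro a b
    have h1 := h.fderiv_inner (h.covDerivAlong_smooth (h.contDiffOn_fderiv w) b)
      (h.contDiffOn_fderiv z) hx a
    have h2 := h.metric.fderiv_apply_apply (F := id) differentiableAt_id hx (hWd w b)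
      (differentiableAt_const z) a
    have e : (fun y => G' (F y) (covDerivAlong G' F (fun y => fderiv ℝ F y w) b y)
        (fderiv ℝ F y z)) =ᶠ[nhds x] fun y => G y (covDeriv G (fun _ => w) b y) z := by
      filter_upwards [h.mem_nhds hx] with y hy using h.inner_covDerivAlong_fderiv hy b w z
    rw [e.fderiv_eq] at h1
    simp only [id, ← covDeriv_eq_covDerivAlong] at h2
    have h3 : G' (F x) (covDerivAlong G' F (fun y => fderiv ℝ F y w) b x)
        (covDerivAlong G' F (fun y => fderiv ℝ F y z) a x) =
        G x (covDeriv G (fun _ => w) b x) (covDeriv G (fun _ => z) a x) +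
          G' (F x) (secondForm G G' F x b w) (secondForm G G' F x a z) := by
      rw [covDerivAlong_fderiv_eq (G := G), covDerivAlong_fderiv_eq (G := G)]
      simp only [map_add, _root_.add_apply, h.isometric x hx, h.inner_secondForm_fderiv hx,
        h.inner_fderiv_secondForm hx]
      ring
    linarith
  have h4 := h.metric'.covDerivAlong_comm h.metric.isOpen h.contDiffOn h.mapsTo
    (h.contDiffOn_fderiv w) hx u v
  rw [← h4, curvature]
  simp only [map_sub, _root_.sub_apply]
  have h5 := key u v
  have h6 := key v u
  linarith

/-- The normal part is normal. -/
lemma inner_normalPart_fderiv (h : IsIsometryOn G U G' U' F) {x : E} (hx : x ∈ U) (ξ : E')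
    (z : E) : G' (F x) (normalPart G G' F x ξ) (fderiv ℝ F x z) = 0 := by
  rw [normalPart, map_sub, _root_.sub_apply, h.isometric x hx, h.metric.apply_inverse hx]
  simp

lemma normalPart_of_normal (x : E) (ξ : E') (hξ : ∀ z, G' (F x) ξ (fderiv ℝ F x z) = 0) :
    normalPart G G' F x ξ = ξ := by
  have : (G' (F x) ξ).comp (fderiv ℝ F x) = 0 := by ext z; exact hξ z
  simp [normalPart, this]

lemma inner_normalPart_of_normal (h : IsIsometryOn G U G' U' F) {x : E} (hx : x ∈ U) (ξ η : E')
    (hη : ∀ z, G' (F x) η (fderiv ℝ F x z) = 0) :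
    G' (F x) (normalPart G G' F x ξ) η = G' (F x) ξ η := by
  rw [normalPart, map_sub, _root_.sub_apply,
    h.metric'.symm _ (h.mapsTo hx) (fderiv ℝ F x _), hη, sub_zero]

lemma contDiffOn_normalPart (h : IsIsometryOn G U G' U' F) {V : E → E'}
    (hV : ContDiffOn ℝ ∞ V U) : ContDiffOn ℝ ∞ (fun y => normalPart G G' F y (V y)) U := by
  have hd := h.contDiffOn.fderiv_of_isOpen (m := ∞) h.metric.isOpen (by simp)
  have h1 := (h.metric'.contDiffOn.comp h.contDiffOn h.mapsTo).clm_apply hV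
  exact hV.sub (hd.clm_apply (h.metric.contDiffOn_inverse.clm_apply (h1.clm_comp hd)))

/-- The equation of Weingarten. -/
lemma inner_covDerivAlong_normal (h : IsIsometryOn G U G' U' F) {N : E → E'}
    (hN : ContDiffOn ℝ ∞ N U) (hn : ∀ y ∈ U, ∀ z, G' (F y) (N y) (fderiv ℝ F y z) = 0)
    {x : E} (hx : x ∈ U) (v z : E) :
    G' (F x) (covDerivAlong G' F N v x) (fderiv ℝ F x z) =
      - G' (F x) (N x) (secondForm G G' F x v z) := by
  have h1 := h.fderiv_inner hN (h.contDiffOn_fderiv z) hx v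
  have e : (fun y => G' (F y) (N y) (fderiv ℝ F y z)) =ᶠ[nhds x] fun _ => 0 := by
    filter_upwards [h.mem_nhds hx] with y hy using hn y hy z
  rw [e.fderiv_eq, covDerivAlong_fderiv_eq (G := G)] at h1
  simp only [map_add, hn x hx, fderiv_fun_const, Pi.zero_apply, _root_.zero_apply] at h1
  linarith

/-- The equation of Ricci. -/
lemma ricci (h : IsIsometryOn G U G' U' F) {x : E} (hx : x ∈ U) {ι : Type*} [Fintype ι]
    (e : ι → E) (he : ∀ a b, G x a b = ∑ k, G x a (e k) * G x b (e k)) (u v : E) (ξ η : E')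
    (hξ : ∀ z, G' (F x) ξ (fderiv ℝ F x z) = 0) (hη : ∀ z, G' (F x) η (fderiv ℝ F x z) = 0) :
    G' (F x) (normalCurvature G G' F x u v ξ) η =
      G' (F x) (curvature G' (F x) (fderiv ℝ F x u) (fderiv ℝ F x v) ξ) η +
      ∑ k, (G' (F x) ξ (secondForm G G' F x v (e k)) * G' (F x) η (secondForm G G' F x u (e k)) -
        G' (F x) ξ (secondForm G G' F x u (e k)) *
          G' (F x) η (secondForm G G' F x v (e k))) := by
  set N : E → E' := fun y => normalPart G G' F y ξ with hNdef
  set Q : E → E' := fun y => normalPart G G' F y η with hQdef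
  have hN : ContDiffOn ℝ ∞ N U := h.contDiffOn_normalPart contDiffOn_const
  have hQ : ContDiffOn ℝ ∞ Q U := h.contDiffOn_normalPart contDiffOn_const
  have hNn : ∀ y ∈ U, ∀ z, G' (F y) (N y) (fderiv ℝ F y z) = 0 := fun y hy z =>
    h.inner_normalPart_fderiv hy ξ z
  have hQn : ∀ y ∈ U, ∀ z, G' (F y) (Q y) (fderiv ℝ F y z) = 0 := fun y hy z =>
    h.inner_normalPart_fderiv hy η z
  have hNx : N x = ξ := normalPart_of_normal x ξ hξ
  have hQx : Q x = η := normalPart_of_normal x η hη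
  -- As `Q` is normal on all of `U`, the projection in `⟨∇^⊥_b N, Q⟩` can be dropped before
  -- differentiating in direction `a`. The correction is the tangential part of `∇̃_b N` paired with
  -- `∇̃_a Q`; expanded in the frame `e`, it is given by Weingarten's equation.
  have key : ∀ a b, G' (F x) (normalCovDeriv G G' F (normalCovDeriv G G' F N b) a x) η =
      G' (F x) (covDerivAlong G' F (covDerivAlong G' F N b) a x) η +
        ∑ k, G' (F x) ξ (secondForm G G' F x b (e k)) *
          G' (F x) η (secondForm G G' F x a (e k)) := by
    intro a b
    have hD : ContDiffOn ℝ ∞ (normalCovDeriv G G' F N b) U :=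
      h.contDiffOn_normalPart (h.covDerivAlong_smooth hN b)
    have h1 := h.fderiv_inner hD hQ hx a
    have h2 := h.fderiv_inner (h.covDerivAlong_smooth hN b) hQ hx a
    have e1 : (fun y => G' (F y) (normalCovDeriv G G' F N b y) (Q y)) =ᶠ[nhds x]
        fun y => G' (F y) (covDerivAlong G' F N b y) (Q y) := by
      filter_upwards [h.mem_nhds hx] with y hy using
        h.inner_normalPart_of_normal hy _ _ (hQn y hy)
    rw [e1.fderiv_eq, h2, hQx] at h1
    have h3 : G' (F x) (normalCovDeriv G G' F (normalCovDeriv G G' F N b) a x) η =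
        G' (F x) (covDerivAlong G' F (normalCovDeriv G G' F N b) a x) η :=
      h.inner_normalPart_of_normal hx _ _ hη
    have tang : ∀ ζ z, G x ((G x).inverse ((G' (F x) ζ).comp (fderiv ℝ F x))) z =
        G' (F x) ζ (fderiv ℝ F x z) := by
      intro ζ z
      rw [h.metric.apply_inverse hx]; rfl
    have h4 : G' (F x) (covDerivAlong G' F N b x) (covDerivAlong G' F Q a x) -
        G' (F x) (normalCovDeriv G G' F N b x) (covDerivAlong G' F Q a x) =
        ∑ k, G' (F x) ξ (secondForm G G' F x b (e k)) *
          G' (F x) η (secondForm G G' F x a (e k)) := by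
      rw [← _root_.sub_apply, ← map_sub, normalCovDeriv, normalPart, sub_sub_cancel,
        h.metric'.symm _ (h.mapsTo hx), ← tang, h.metric.symm x hx, he]
      simp only [tang, h.inner_covDerivAlong_normal hN hNn hx,
        h.inner_covDerivAlong_normal hQ hQn hx, hNx, hQx, neg_mul_neg]
    linarith
  have h4 := h.metric'.covDerivAlong_comm h.metric.isOpen h.contDiffOn h.mapsTo hN hx u v
  rw [← hNx, ← h4, hNx, normalCurvature]
  simp only [map_sub, _root_.sub_apply, Finset.sum_sub_distrib]
  have h5 := key u v
  have h6 := key v u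
  linarith

end IsIsometryOn

/-! ### Constant sectional curvature and orthonormal expansions. -/

/-- An algebraic curvature tensor with vanishing sectional curvatures vanishes. -/
lemma eq_zero_of_sectional_eq_zero {V : Type*} [AddCommGroup V] (T : V → V → V → V → ℝ)
    (add₁ : ∀ a a' b c d, T (a + a') b c d = T a b c d + T a' b c d)
    (add₄ : ∀ a b c d d', T a b c (d + d') = T a b c d + T a b c d')
    (add₂ : ∀ a b b' c d, T a (b + b') c d = T a b c d + T a b' c d)
    (add₃ : ∀ a b c c' d, T a b (c + c') d = T a b c d + T a b c' d)
    (skew₁ : ∀ a b c d, T a b c d = - T b a c d) (skew₂ : ∀ a b c d, T a b c d = - T a b d c)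
    (bianchi : ∀ a b c d, T a b c d + T b c a d + T c a b d = 0)
    (sec : ∀ a b, T a b b a = 0) (a b c d : V) : T a b c d = 0 := by
  have pair : ∀ a b c d, T a b c d = T c d a b := by
    intro a b c d
    -- The classical combination of the four cyclic shifts of the Bianchi identity, simplified by
    -- the two skew symmetries.
    linarith [bianchi a b c d, bianchi b c d a, bianchi c d a b, bianchi d a b c, skew₁ a b c d,
      skew₁ b c a d, skew₁ c a b d, skew₁ c d a b, skew₂ a b c d, skew₂ c d a b, skew₂ b c a d,
      skew₂ c a b d, skew₂ b c d a, skew₂ d a b c, skew₂ d b c a, skew₁ b d c a, skew₁ d a b c,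
      skew₂ a c d b, skew₁ a c d b, skew₂ b d a c, skew₁ b d a c, skew₂ c a d b, skew₂ d b a c,
      skew₁ d b c a, skew₂ b d c a, skew₁ a c b d]
  -- Polarise in the outer arguments; `h2` then polarises in the inner ones.
  have h1 : ∀ a b d, T a b b d = 0 := by
    intro a b d
    have h := sec (a + d) b
    rw [add₁, add₄, add₄, sec, sec] at h
    have := pair d b b a
    have := skew₁ b a d b
    have := skew₂ a b d b
    linarith
  have h2 : ∀ a b c d, T a b c d = - T a c b d := by
    intro a b c d
    have h := h1 a (b + c) d
    rw [add₂, add₃, add₃, h1, h1] at h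
    linarith
  -- Skewness in neighbouring arguments makes the three Bianchi terms equal, so `3 T = 0`.
  linarith [bianchi a b c d, h2 b c a d, skew₁ b a c d, skew₁ c a b d, h2 a c b d]

end

section Local

variable {E : Type*} [NormedAddCommGroup E] [NormedSpace ℝ E] [FiniteDimensional ℝ E]

/-- In a manifold of constant curvature `c`, `R(u, v)w = c (⟨v, w⟩ u - ⟨u, w⟩ v)`. -/
lemma IsMetricOn.curvature_of_sectional {G : E → E →L[ℝ] E →L[ℝ] ℝ} {U : Set E}
    (hG : IsMetricOn G U) {x : E} (hx : x ∈ U) {c : ℝ}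
    (hc : ∀ v w, LinearIndependent ℝ ![v, w] →
      G x (curvature G x v w w) v / (G x v v * G x w w - G x v w ^ 2) = c) (u v w z : E) :
    G x (curvature G x u v w) z = c * (G x v w * G x u z - G x u w * G x v z) := by
  have hs := hG.symm x hx
  have skew : ∀ a b d, curvature G x a b d = - curvature G x b a d := by
    intro a b d; simp [curvature]
  have smul₁ : ∀ (t : ℝ) a b d, curvature G x (t • a) b d = t • curvature G x a b d := by
    intro t a b d
    simp only [hG.curvature_eq hx, map_smul, _root_.smul_apply, smul_add, smul_sub]
  have hself : ∀ a b, curvature G x a a b = 0 := fun a b => by simp [curvature]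
  -- The difference from the model tensor of curvature `c` is again an algebraic curvature tensor.
  -- Its sectional values vanish by `hc` on independent pairs and by skewness or linearity on
  -- dependent ones.
  refine sub_eq_zero.1 (eq_zero_of_sectional_eq_zero
    (fun a b d f => G x (curvature G x a b d) f - c * (G x b d * G x a f - G x a d * G x b f))
    ?_ ?_ ?_ ?_ ?_ ?_ ?_ ?_ u v w z)
  · intro a a' b d f
    simp only [hG.curvature_eq hx, map_add, map_sub, _root_.add_apply, _root_.sub_apply]
    ring
  · intro a b d f f'
    simp only [map_add]
    ring
  · intro a b b' d f
    simp only [hG.curvature_eq hx, map_add, map_sub, _root_.add_apply, _root_.sub_apply]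
    ring
  · intro a b d d' f
    simp only [hG.curvature_eq hx, map_add, map_sub, _root_.add_apply, _root_.sub_apply]
    ring
  · intro a b d f
    simp only [skew a b, map_neg, _root_.neg_apply]
    ring
  · intro a b d f
    simp only [hG.apply_curvature_skew hx a b d]
    ring
  · intro a b d f
    have := congrArg (fun y => G x y f) (hG.curvature_bianchi hx a b d)
    simp only [map_add, _root_.add_apply, map_zero, _root_.zero_apply] at this
    simp only [hs b a, hs d a, hs d b]
    linarith
  · intro a b
    by_cases hb : b = 0
    · have h0 : curvature G x a 0 0 = 0 := by
        rw [skew]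
        simpa using smul₁ 0 0 a 0
      simp [h0, hb]
    by_cases hab : ∃ t : ℝ, t • b = a
    · obtain ⟨t, rfl⟩ := hab
      simp only [smul₁, hself, map_smul, _root_.smul_apply, smul_zero, map_zero, _root_.zero_apply,
        smul_eq_mul]
      ring
    · have hli : LinearIndependent ℝ ![a, b] :=
        LinearIndependent.pair_symm_iff.1 ((LinearIndependent.pair_iff' hb).2 fun t ht => hab ⟨t, ht⟩)
      have hbb := hG.pos x hx b hb
      -- The squared length of this vector is `G x b b` times the Gram determinant of `a`, `b`, so
      -- the denominator in `hc` is positive.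
      have hne : G x b b • a - G x a b • b ≠ 0 := by
        intro h0
        refine hab ⟨(G x b b)⁻¹ * G x a b, ?_⟩
        rw [mul_smul, ← sub_eq_zero.1 h0, smul_smul, inv_mul_cancel₀ hbb.ne', one_smul]
      have hpos := hG.pos x hx _ hne
      have hpos' : 0 < G x b b * (G x a a * G x b b - G x a b ^ 2) := by
        refine hpos.trans_eq ?_
        simp only [map_sub, map_smul, _root_.sub_apply, _root_.smul_apply, smul_eq_mul, hs b a]
        ring
      have hD := (pos_iff_pos_of_mul_pos hpos').1 hbb
      have := (div_eq_iff hD.ne').1 (hc a b hli)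
      rw [this, hs b a]
      ring

/-- Parseval's identity for an orthonormal system of maximal size. -/
lemma apply_eq_sum_of_orthonormal {ι : Type*} [Fintype ι] [DecidableEq ι] (B : E →L[ℝ] E →L[ℝ] ℝ)
    (e : ι → E) (he : ∀ i j, B (e i) (e j) = if i = j then 1 else 0)
    (hcard : Fintype.card ι = Module.finrank ℝ E) (v w : E) :
    B v w = ∑ k, B v (e k) * B w (e k) := by
  have hli : LinearIndependent ℝ e := by
    rw [Fintype.linearIndependent_iff]
    intro a ha i
    have := congrArg (fun y => B y (e i)) ha
    simpa [he] using this
  rcases isEmpty_or_nonempty ι with hι | hι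
  -- The basis constructed below needs a nonempty index type; dimension zero is treated apart.
  · have : Subsingleton E := by
      rw [← Module.finrank_zero_iff (R := ℝ), ← hcard, Fintype.card_eq_zero]
    simp [Subsingleton.elim v 0]
  set b := basisOfLinearIndependentOfCardEqFinrank hli hcard
  have hb : ∀ i, b i = e i := fun i => by simp [b]
  have hw : ∀ i, B w (e i) = b.repr w i := by
    intro i
    conv_lhs => rw [← b.sum_repr w]
    simp [hb, he]
  conv_lhs => rw [← b.sum_repr w]
  simp only [map_sum, map_smul, smul_eq_mul, hw, hb]
  exact Finset.sum_congr rfl fun i _ => mul_comm _ _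

end Local

/-! ### From the commutator inequality to the inequality for shape operators. -/

section Algebra

lemma sum_sum_eq_two_mul_sum_Ioi {n : ℕ} (f : Fin n → Fin n → ℝ) (hf : ∀ i j, f i j = f j i) :
    ∑ i, ∑ j, f i j = 2 * (∑ i, ∑ j ∈ Finset.Ioi i, f i j) + ∑ i, f i i := by
  have h1 : ∀ i, ∑ j, f i j = ∑ j ∈ Finset.Ioi i, f i j + ∑ j ∈ Finset.Iio i, f i j + f i i := by
    intro i
    have : (Finset.univ : Finset (Fin n)) = (Finset.Ioi i ∪ Finset.Iio i) ∪ {i} := by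
      ext j
      simp only [Finset.mem_univ, Finset.mem_union, Finset.mem_Ioi, Finset.mem_Iio,
        Finset.mem_singleton, true_iff]
      rcases lt_trichotomy i j with h | h | h <;> simp [h]
    rw [this, Finset.sum_union, Finset.sum_union, Finset.sum_singleton]
    · rw [Finset.disjoint_left]
      intro j hj hj'
      exact lt_asymm (Finset.mem_Ioi.1 hj) (Finset.mem_Iio.1 hj')
    · simp
  have h2 : ∑ i, ∑ j ∈ Finset.Iio i, f i j = ∑ i, ∑ j ∈ Finset.Ioi i, f i j := by
    rw [Finset.sum_comm' (t' := Finset.univ) (s' := fun j => Finset.Ioi j) (by simp)]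
    exact Finset.sum_congr rfl fun i _ => Finset.sum_congr rfl fun j _ => hf _ _
  simp only [h1, Finset.sum_add_distrib, h2]
  ring

lemma matNormSq_eq_sum {n : ℕ} (A : Matrix (Fin n) (Fin n) ℝ) :
    matNormSq A = ∑ i, ∑ j, A i j ^ 2 := by
  rw [Finset.sum_comm]
  simp [matNormSq, Matrix.trace, Matrix.mul_apply, sq]

/-- The algebraic form of the normal scalar curvature inequality, for the shape operators `A`. -/
lemma normal_scalar_inequality {n m : ℕ} (hn : 2 ≤ n)
    (hmat : ∀ B : Fin m → Matrix (Fin n) (Fin n) ℝ,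
      (∀ α, (B α).IsSymm ∧ (B α).trace = 0) →
        ∑ α, ∑ β, matNormSq (B α * B β - B β * B α) ≤ (∑ α, matNormSq (B α)) ^ 2)
    (A : Fin m → Matrix (Fin n) (Fin n) ℝ) (hA : ∀ α i j, A α i j = A α j i) (c : ℝ) :
    2 / ((n : ℝ) * ((n : ℝ) - 1)) *
        ∑ i, ∑ j ∈ Finset.Ioi i, (c + ∑ α, (A α j j * A α i i - A α i j ^ 2)) ≤
      ∑ α, (1 / (n : ℝ) * ∑ i, A α i i) ^ 2 -
        2 / ((n : ℝ) * ((n : ℝ) - 1)) *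
          √(∑ i, ∑ j ∈ Finset.Ioi i, ∑ α, ∑ β ∈ Finset.Ioi α,
            (∑ k, (A α j k * A β i k - A α i k * A β j k)) ^ 2) + c := by
  have hn2 : (2 : ℝ) ≤ n := by exact_mod_cast hn
  have hn0 : (0 : ℝ) < n := by linarith
  have hn1 : (0 : ℝ) < (n : ℝ) - 1 := by linarith
  set t : Fin m → ℝ := fun α => ∑ i, A α i i with ht
  -- The traceless parts, to which `hmat` applies; the scalar matrices subtracted commute with
  -- everything.
  set B : Fin m → Matrix (Fin n) (Fin n) ℝ :=
    fun α => A α - (t α / n) • (1 : Matrix (Fin n) (Fin n) ℝ) with hB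
  have hcomm : ∀ α β, B α * B β - B β * B α = A α * A β - A β * A α := by
    intro α β
    simp only [hB, sub_mul, mul_sub, smul_mul_assoc, mul_smul_comm, one_mul, mul_one]
    simp only [smul_sub, smul_smul, mul_comm (t β / n)]
    abel
  have hBnorm : ∀ α, matNormSq (B α) = ∑ i, ∑ j, A α i j ^ 2 - t α ^ 2 / n := by
    intro α
    have e : ∀ i j, B α i j ^ 2 = A α i j ^ 2 +
        (if i = j then (t α / n) ^ 2 - 2 * (t α / n) * A α i i else 0) := by
      intro i j
      by_cases h : i = j
      · subst h; simp [hB]; ring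
      · simp [hB, h]
    rw [matNormSq_eq_sum]
    simp only [e, Finset.sum_add_distrib, Finset.sum_ite_eq, Finset.mem_univ, if_true,
      Finset.sum_sub_distrib, ← Finset.mul_sum]
    simp only [Finset.sum_const, Finset.card_univ, Fintype.card_fin, nsmul_eq_mul]
    change _ + (_ - 2 * (t α / n) * t α) = _
    field_simp
    ring
  set S := ∑ α, matNormSq (B α) with hS
  have hS0 : 0 ≤ S := Finset.sum_nonneg fun α _ => by
    rw [matNormSq_eq_sum]; positivity
  have hK := hmat B fun α => by
    constructor
    · ext i j
      by_cases h : i = j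
      · subst h; rfl
      · simp [hB, h, Ne.symm h, hA α i j]
    · simp only [hB, Matrix.trace_sub, Matrix.trace_smul, Matrix.trace_one, Fintype.card_fin,
        smul_eq_mul]
      change t α - t α / n * n = 0
      field_simp
      ring
  have hentry : ∀ i j α β, ((A α * A β - A β * A α) i j) ^ 2 =
      (∑ k, (A α j k * A β i k - A α i k * A β j k)) ^ 2 := by
    intro i j α β
    rw [Matrix.sub_apply, Matrix.mul_apply, Matrix.mul_apply, ← Finset.sum_sub_distrib, ← neg_sq,
      ← Finset.sum_neg_distrib]
    congr 1
    refine Finset.sum_congr rfl fun k _ => ?_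
    rw [hA β k j, hA α k j]
    ring
  set Q : Fin n → Fin n → Fin m → Fin m → ℝ := fun i j α β =>
    (∑ k, (A α j k * A β i k - A α i k * A β j k)) ^ 2 with hQ
  -- The full commutator sum meets each pair `i < j` and each pair `α < β` twice, and the diagonal
  -- terms vanish; hence the factor `4`.
  have hQ4 : 4 * (∑ i, ∑ j ∈ Finset.Ioi i, ∑ α, ∑ β ∈ Finset.Ioi α, Q i j α β) ≤ S ^ 2 := by
    refine le_trans (le_of_eq ?_) hK
    have q1 : ∀ i j α β, Q i j α β = Q i j β α := by
      intro i j α β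
      simp only [hQ]
      rw [← neg_sq, ← Finset.sum_neg_distrib]
      congr 1
      exact Finset.sum_congr rfl fun k _ => by ring
    have q2 : ∀ i j α β, Q i j α β = Q j i α β := by
      intro i j α β
      simp only [hQ]
      rw [← neg_sq, ← Finset.sum_neg_distrib]
      congr 1
      exact Finset.sum_congr rfl fun k _ => by ring
    have q3 : ∀ i j α, Q i j α α = 0 := by
      intro i j α
      simp only [hQ]
      rw [Finset.sum_eq_zero fun k _ => by ring]
      simp
    have q4 : ∀ i α β, Q i i α β = 0 := by
      intro i α β
      simp only [hQ]
      rw [Finset.sum_eq_zero fun k _ => by ring]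
      simp
    have e1 : ∑ α, ∑ β, matNormSq (B α * B β - B β * B α) = ∑ i, ∑ j, ∑ α, ∑ β, Q i j α β := by
      simp only [hcomm, matNormSq_eq_sum, hentry]
      simp only [← Finset.sum_product']
      refine Finset.sum_bij' (fun a _ => (a.2.2.1, a.2.2.2, a.1, a.2.1))
        (fun a _ => (a.2.2.1, a.2.2.2, a.1, a.2.1)) ?_ ?_ ?_ ?_ ?_ <;> simp [hQ]
    have e2 : ∀ i j, ∑ α, ∑ β, Q i j α β = 2 * ∑ α, ∑ β ∈ Finset.Ioi α, Q i j α β := by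
      intro i j
      rw [sum_sum_eq_two_mul_sum_Ioi _ (q1 i j)]
      simp [q3]
    rw [e1, sum_sum_eq_two_mul_sum_Ioi]
    · simp only [e2, ← Finset.mul_sum, q4]
      simp
      ring
    · intro i j
      exact Finset.sum_congr rfl fun α _ => Finset.sum_congr rfl fun β _ => q2 ..
  have hsqrt : 2 * √(∑ i, ∑ j ∈ Finset.Ioi i, ∑ α, ∑ β ∈ Finset.Ioi α, Q i j α β) ≤ S := by
    have : √(∑ i, ∑ j ∈ Finset.Ioi i, ∑ α, ∑ β ∈ Finset.Ioi α, Q i j α β) ≤ S / 2 := by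
      rw [Real.sqrt_le_left (by positivity)]
      linarith
    linarith
  have hscal : 2 * ∑ i, ∑ j ∈ Finset.Ioi i, (c + ∑ α, (A α j j * A α i i - A α i j ^ 2)) =
      n * (n - 1) * c + ∑ α, (t α ^ 2 - ∑ i, ∑ j, A α i j ^ 2) := by
    have h := sum_sum_eq_two_mul_sum_Ioi
      (fun i j => c + ∑ α, (A α j j * A α i i - A α i j ^ 2)) (fun i j => by
        congr 1
        exact Finset.sum_congr rfl fun α _ => by rw [hA α i j]; ring)
    have h1 : ∑ i, ∑ j, ∑ α, (A α j j * A α i i - A α i j ^ 2) =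
        ∑ α, (t α ^ 2 - ∑ i, ∑ j, A α i j ^ 2) := by
      simp only [Finset.sum_comm (s := Finset.univ (α := Fin n)) (t := Finset.univ (α := Fin m))]
      refine Finset.sum_congr rfl fun α _ => ?_
      simp only [Finset.sum_sub_distrib, ht, sq (∑ i, A α i i), Finset.sum_mul_sum]
      congr 1
      exact Finset.sum_congr rfl fun i _ => Finset.sum_congr rfl fun j _ => mul_comm _ _
    have h2 : ∑ i : Fin n, (c + ∑ α, (A α i i * A α i i - A α i i ^ 2)) = n * c := by
      have : ∀ (i : Fin n), ∑ α, (A α i i * A α i i - A α i i ^ 2) = 0 := fun i =>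
        Finset.sum_eq_zero fun α _ => by ring
      simp [this]
    simp only [h2] at h
    simp only [Finset.sum_add_distrib (f := fun _ => c), Finset.sum_const, Finset.card_univ,
      Fintype.card_fin, nsmul_eq_mul] at h
    rw [Finset.sum_add_distrib, h1] at h
    simp only [Finset.sum_const, Finset.card_univ, Fintype.card_fin, nsmul_eq_mul] at h
    simp only [Finset.sum_add_distrib, Finset.sum_const, nsmul_eq_mul] at h ⊢
    linarith
  have hSsum : S = ∑ α, (∑ i, ∑ j, A α i j ^ 2 - t α ^ 2 / n) :=
    Finset.sum_congr rfl fun α _ => hBnorm α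
  have hmean : ∑ α, (1 / (n : ℝ) * t α) ^ 2 = (∑ α, t α ^ 2) / n ^ 2 := by
    rw [Finset.sum_div]
    exact Finset.sum_congr rfl fun α _ => by ring
  rw [hmean]
  rw [Finset.sum_sub_distrib, ← Finset.sum_div] at hSsum
  rw [Finset.sum_sub_distrib] at hscal
  set X := ∑ i, ∑ j ∈ Finset.Ioi i, (c + ∑ α, (A α j j * A α i i - A α i j ^ 2))
  set Y := √(∑ i, ∑ j ∈ Finset.Ioi i, ∑ α, ∑ β ∈ Finset.Ioi α, Q i j α β)
  set P := ∑ α, t α ^ 2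
  set R := ∑ α, ∑ i, ∑ j, A α i j ^ 2
  -- Add `2X = n(n-1)c + P - R` and `2Y ≤ S = R - P/n`: the term `R` cancels, and `P - P/n = n(n-1)
  -- P/n²`.
  have hfin : 2 * X + 2 * Y ≤ n * (n - 1) * (P / n ^ 2 + c) := by
    have : (n : ℝ) * (n - 1) * (P / n ^ 2 + c) = n * (n - 1) * c + P - P / n := by
      field_simp; ring
    linarith
  have hN : (0 : ℝ) < n * (n - 1) := mul_pos hn0 hn1
  have : (2 * X + 2 * Y) / (n * (n - 1)) ≤ P / n ^ 2 + c := by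
    rw [div_le_iff₀ hN]; linarith
  have e : (2 * X + 2 * Y) / ((n : ℝ) * (n - 1)) =
      2 / (n * (n - 1)) * X + 2 / (n * (n - 1)) * Y := by ring
  linarith

end Algebra

/-! ### Passage from manifolds to coordinates. -/

section Charts

variable {n k : ℕ}
  {M : Type*} [TopologicalSpace M] [ChartedSpace (EuclideanSpace ℝ (Fin n)) M]
  [IsManifold (𝓡 n) ∞ M]
  {N : Type*} [TopologicalSpace N] [ChartedSpace (EuclideanSpace ℝ (Fin k)) N]
  [IsManifold (𝓡 k) ∞ N]

lemma metricInChart_apply (g : RiemMetric n M) (p : M) (x v w : EuclideanSpace ℝ (Fin n)) :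
    metricInChart g p x v w = g.inner ((extChartAt (𝓡 n) p).symm x)
      (mfderiv 𝓘(ℝ, EuclideanSpace ℝ (Fin n)) (𝓡 n) (extChartAt (𝓡 n) p).symm x v)
      (mfderiv 𝓘(ℝ, EuclideanSpace ℝ (Fin n)) (𝓡 n) (extChartAt (𝓡 n) p).symm x w) := rfl

variable (n) in
lemma one_le_infty_manifold : IsManifold (𝓡 n) 1 M :=
  IsManifold.of_le (n := ∞) (by simp)

lemma injective_mfderiv_extChartAt_symm (p : M) {x : EuclideanSpace ℝ (Fin n)}
    (hx : x ∈ (extChartAt (𝓡 n) p).target) :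
    Function.Injective
      (mfderiv 𝓘(ℝ, EuclideanSpace ℝ (Fin n)) (𝓡 n) (extChartAt (𝓡 n) p).symm x) := by
  have := one_le_infty_manifold n (M := M)
  have h := isInvertible_mfderivWithin_extChartAt_symm (I := 𝓡 n) hx
  rw [ModelWithCorners.Boundaryless.range_eq_univ, mfderivWithin_univ] at h
  exact h.injective

/-- In finite dimension smoothness can be tested on constant vectors `v`, `w`. The tangent map of
the inverse chart turns these into smooth fields, and the smooth bundle metric is evaluated on them.
-/
lemma contDiffOn_metricInChart (g : RiemMetric n M) (p : M) :
    ContDiffOn ℝ ∞ (metricInChart g p) (extChartAt (𝓡 n) p).target := by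
  have hopen : IsOpen (extChartAt (𝓡 n) p).target := isOpen_extChartAt_target p
  have hsymm := contMDiffOn_extChartAt_symm (I := 𝓡 n) (n := ∞) p
  have hsec : ∀ v : EuclideanSpace ℝ (Fin n),
      ContMDiffOn 𝓘(ℝ, EuclideanSpace ℝ (Fin n)) ((𝓡 n).prod 𝓘(ℝ, EuclideanSpace ℝ (Fin n))) ∞
      (fun x => Bundle.TotalSpace.mk' (EuclideanSpace ℝ (Fin n))
        (E := fun q : M => TangentSpace (𝓡 n) q) ((extChartAt (𝓡 n) p).symm x)
        (mfderiv 𝓘(ℝ, EuclideanSpace ℝ (Fin n)) (𝓡 n) (extChartAt (𝓡 n) p).symm x v))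
      (extChartAt (𝓡 n) p).target := by
    intro v
    have h1 := hsymm.contMDiffOn_tangentMapWithin (m := ∞) (by simp) hopen.uniqueMDiffOn
    have h2 : ContMDiffOn 𝓘(ℝ, EuclideanSpace ℝ (Fin n))
        (𝓘(ℝ, EuclideanSpace ℝ (Fin n)).prod 𝓘(ℝ, EuclideanSpace ℝ (Fin n))) ∞
        (fun x : EuclideanSpace ℝ (Fin n) =>
          (⟨x, v⟩ : TangentBundle 𝓘(ℝ, EuclideanSpace ℝ (Fin n)) (EuclideanSpace ℝ (Fin n))))
        (extChartAt (𝓡 n) p).target :=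
      contMDiffOn_vectorSpace_iff_contDiffOn.2 contDiffOn_const
    refine (h1.comp h2 fun x hx => hx).congr fun x hx => ?_
    simp only [Function.comp_apply, tangentMapWithin, mfderivWithin_of_isOpen hopen hx]
  rw [contDiffOn_clm_apply]
  intro v
  rw [contDiffOn_clm_apply]
  intro w
  have h3 := ContMDiffOn.clm_bundle_apply₂ (F₁ := EuclideanSpace ℝ (Fin n))
    (F₂ := EuclideanSpace ℝ (Fin n)) (F₃ := ℝ) (E₃ := Bundle.Trivial M ℝ)
    (b := (extChartAt (𝓡 n) p).symm)
    (g.contMDiff.comp_contMDiffOn hsymm) (hsec v) (hsec w)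
  intro x hx
  have h4 := h3 x hx
  simp only [Bundle.contMDiffWithinAt_totalSpace] at h4
  exact h4.2.contDiffWithinAt

lemma isMetricOn_metricInChart (g : RiemMetric n M) (p : M) :
    IsMetricOn (metricInChart g p) (extChartAt (𝓡 n) p).target where
  isOpen := isOpen_extChartAt_target p
  contDiffOn := contDiffOn_metricInChart g p
  symm x _ v w := g.symm _ _ _
  pos x hx v hv := by
    rw [metricInChart_apply]
    refine g.pos _ _ fun h0 => hv ?_
    exact injective_mfderiv_extChartAt_symm p hx (h0.trans (map_zero _).symm)

lemma metricInChart_extChartAt (g : RiemMetric n M) (p : M) {q : M}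
    (hq : q ∈ (extChartAt (𝓡 n) p).source) (v w : TangentSpace (𝓡 n) q) :
    metricInChart g p (extChartAt (𝓡 n) p q)
      (mfderiv (𝓡 n) 𝓘(ℝ, EuclideanSpace ℝ (Fin n)) (extChartAt (𝓡 n) p) q v)
      (mfderiv (𝓡 n) 𝓘(ℝ, EuclideanSpace ℝ (Fin n)) (extChartAt (𝓡 n) p) q w) =
      g.inner q v w := by
  have := one_le_infty_manifold n (M := M)
  have h := mfderivWithin_extChartAt_symm_comp_mfderiv_extChartAt' (I := 𝓡 n) hq
  rw [ModelWithCorners.Boundaryless.range_eq_univ, mfderivWithin_univ] at h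
  have h' : ∀ z : TangentSpace (𝓡 n) q,
      (mfderiv 𝓘(ℝ, EuclideanSpace ℝ (Fin n)) (𝓡 n) (extChartAt (𝓡 n) p).symm
        (extChartAt (𝓡 n) p q)
        (mfderiv (𝓡 n) 𝓘(ℝ, EuclideanSpace ℝ (Fin n)) (extChartAt (𝓡 n) p) q z) :
        EuclideanSpace ℝ (Fin n)) = z := fun z =>
    congrArg (fun A : EuclideanSpace ℝ (Fin n) →L[ℝ] EuclideanSpace ℝ (Fin n) => A z) h
  -- The point `φ⁻¹(φ q)` equals `q` only propositionally while the tangent spaces depend on it, so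
  -- the base point is generalised before substitution.
  have hbase : ∀ q' : M, q' = q → ∀ a b : EuclideanSpace ℝ (Fin n), a = v → b = w →
      (g.inner q' : EuclideanSpace ℝ (Fin n) →L[ℝ] EuclideanSpace ℝ (Fin n) →L[ℝ] ℝ) a b =
        g.inner q v w := by
    rintro q' rfl a b rfl rfl
    rfl
  exact hbase _ ((extChartAt (𝓡 n) p).left_inv hq) _ _ (h' v) (h' w)

lemma isInvertible_toChart (p : M) : (toChart n p).IsInvertible := by
  have := one_le_infty_manifold n (M := M)
  exact isInvertible_mfderiv_extChartAt (mem_extChartAt_source p)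

lemma toChart_ofChart (p : M) (v : EuclideanSpace ℝ (Fin n)) : toChart n p (ofChart n p v) = v :=
  (isInvertible_toChart p).self_apply_inverse v

lemma metricInChart_toChart (g : RiemMetric n M) (p : M) (v w : TangentSpace (𝓡 n) p) :
    metricInChart g p (extChartAt (𝓡 n) p p) (toChart n p v) (toChart n p w) = g.inner p v w :=
  metricInChart_extChartAt g p (mem_extChartAt_source p) v w

/-- The part of the chart at `p` that `f` maps into the chart at `f p`. -/
def chartDomain (f : M → N) (p : M) : Set (EuclideanSpace ℝ (Fin n)) :=
  (extChartAt (𝓡 n) p).target ∩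
    (extChartAt (𝓡 n) p).symm ⁻¹' (f ⁻¹' (extChartAt (𝓡 k) (f p)).source)

lemma extChartAt_mem_chartDomain (f : M → N) (p : M) :
    extChartAt (𝓡 n) p p ∈ chartDomain (n := n) (k := k) f p :=
  ⟨mem_extChartAt_target p, by simp⟩

lemma mfderiv_writtenInExtChartAt {f : M → N} (hf : ContMDiff (𝓡 n) (𝓡 k) ∞ f) {p : M}
    {x : EuclideanSpace ℝ (Fin n)} (hx : x ∈ chartDomain (n := n) (k := k) f p)
    (v : EuclideanSpace ℝ (Fin n)) :
    fderiv ℝ (writtenInExtChartAt (𝓡 n) (𝓡 k) p f) x v =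
      mfderiv (𝓡 k) 𝓘(ℝ, EuclideanSpace ℝ (Fin k)) (extChartAt (𝓡 k) (f p))
        (f ((extChartAt (𝓡 n) p).symm x))
        (mfderiv (𝓡 n) (𝓡 k) f ((extChartAt (𝓡 n) p).symm x)
          (mfderiv 𝓘(ℝ, EuclideanSpace ℝ (Fin n)) (𝓡 n) (extChartAt (𝓡 n) p).symm x v)) := by
  have := one_le_infty_manifold n (M := M)
  have := one_le_infty_manifold k (M := N)
  have h1 : MDifferentiableAt 𝓘(ℝ, EuclideanSpace ℝ (Fin n)) (𝓡 n)
      (extChartAt (𝓡 n) p).symm x := by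
    have h := mdifferentiableWithinAt_extChartAt_symm (I := 𝓡 n) hx.1
    rwa [ModelWithCorners.Boundaryless.range_eq_univ, mdifferentiableWithinAt_univ] at h
  have h2 : MDifferentiableAt (𝓡 n) (𝓡 k) f ((extChartAt (𝓡 n) p).symm x) :=
    hf.mdifferentiable (by simp) _
  have h3 : MDifferentiableAt (𝓡 k) 𝓘(ℝ, EuclideanSpace ℝ (Fin k)) (extChartAt (𝓡 k) (f p))
      (f ((extChartAt (𝓡 n) p).symm x)) :=
    mdifferentiableAt_extChartAt (by simpa using hx.2)
  rw [← mfderiv_eq_fderiv]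
  have h4 : HasMFDerivAt 𝓘(ℝ, EuclideanSpace ℝ (Fin n)) 𝓘(ℝ, EuclideanSpace ℝ (Fin k))
      (writtenInExtChartAt (𝓡 n) (𝓡 k) p f) x _ :=
    h3.hasMFDerivAt.comp x (h2.hasMFDerivAt.comp x h1.hasMFDerivAt)
  rw [h4.mfderiv]
  rfl

/-- Near `p`, the map `f` followed by the target chart also factors through the source chart; the
chain rule for both factorisations gives the same derivative. -/
lemma fderiv_writtenInExtChartAt_toChart {f : M → N} (hf : ContMDiff (𝓡 n) (𝓡 k) ∞ f) (p : M)
    (v : TangentSpace (𝓡 n) p) :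
    fderiv ℝ (writtenInExtChartAt (𝓡 n) (𝓡 k) p f) (extChartAt (𝓡 n) p p) (toChart n p v) =
      toChart k (f p) (mfderiv (𝓡 n) (𝓡 k) f p v) := by
  have := one_le_infty_manifold n (M := M)
  have := one_le_infty_manifold k (M := N)
  have h1 : HasMFDerivAt (𝓡 n) 𝓘(ℝ, EuclideanSpace ℝ (Fin k)) (extChartAt (𝓡 k) (f p) ∘ f) p _ :=
    ((mdifferentiableAt_extChartAt (mem_chart_source _ (f p))).hasMFDerivAt (I := 𝓡 k)).comp p
      (hf.mdifferentiable (by simp) p).hasMFDerivAt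
  have hd : DifferentiableAt ℝ (writtenInExtChartAt (𝓡 n) (𝓡 k) p f) (extChartAt (𝓡 n) p p) := by
    have h := (hf.mdifferentiable (by simp) p).differentiableWithinAt_writtenInExtChartAt
    rwa [ModelWithCorners.Boundaryless.range_eq_univ, differentiableWithinAt_univ] at h
  have h2 := hd.hasFDerivAt.hasMFDerivAt.comp p
    ((mdifferentiableAt_extChartAt (mem_chart_source _ p)).hasMFDerivAt (I := 𝓡 n))
  have h3 : (writtenInExtChartAt (𝓡 n) (𝓡 k) p f ∘ extChartAt (𝓡 n) p) =ᶠ[nhds p]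
      (extChartAt (𝓡 k) (f p) ∘ f) := by
    filter_upwards [extChartAt_source_mem_nhds (I := 𝓡 n) p] with q hq
    simp only [Function.comp_apply, writtenInExtChartAt, (extChartAt (𝓡 n) p).left_inv hq]
  have h4 := hasMFDerivAt_unique h2 (h1.congr_of_eventuallyEq h3)
  exact congrArg (fun A : EuclideanSpace ℝ (Fin n) →L[ℝ] EuclideanSpace ℝ (Fin k) => A v) h4

lemma isIsometryOn_writtenInExtChartAt {g : RiemMetric n M} {g' : RiemMetric k N} {f : M → N}
    (hf : IsIsometricImmersion g g' f) (p : M) :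
    IsIsometryOn (metricInChart g p) (chartDomain (n := n) (k := k) f p)
      (metricInChart g' (f p)) (extChartAt (𝓡 k) (f p)).target
      (writtenInExtChartAt (𝓡 n) (𝓡 k) p f) where
  metric := by
    have h := isMetricOn_metricInChart g p
    exact ⟨(continuousOn_extChartAt_symm p).isOpen_inter_preimage (isOpen_extChartAt_target p)
        ((isOpen_extChartAt_source (f p)).preimage hf.contMDiff.continuous),
      h.contDiffOn.mono inter_subset_left, fun x hx => h.symm x hx.1, fun x hx => h.pos x hx.1⟩
  metric' := isMetricOn_metricInChart g' (f p)
  contDiffOn := by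
    rw [← contMDiffOn_iff_contDiffOn]
    exact (contMDiffOn_extChartAt (I := 𝓡 k) (n := ∞) (x := f p)).comp
      (hf.contMDiff.comp_contMDiffOn
        ((contMDiffOn_extChartAt_symm (I := 𝓡 n) p).mono inter_subset_left))
      fun x hx => by simpa using hx.2
  mapsTo x hx := (extChartAt (𝓡 k) (f p)).map_source hx.2
  isometric x hx v w := by
    rw [mfderiv_writtenInExtChartAt hf.contMDiff hx, mfderiv_writtenInExtChartAt hf.contMDiff hx]
    exact (metricInChart_extChartAt g' (f p) hx.2 _ _).trans (hf.isometric _ _ _)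

end Charts

end Submanifold

end

/-! ### Evaluation of the curvatures in the given frames. -/

theorem theorem2 (n m : ℕ) (hn : 2 ≤ n)
    (hmat : ∀ B : Fin m → Matrix (Fin n) (Fin n) ℝ,
      (∀ α, (B α).IsSymm ∧ (B α).trace = 0) →
        ∑ α, ∑ β, Submanifold.matNormSq (B α * B β - B β * B α) ≤
          (∑ α, Submanifold.matNormSq (B α)) ^ 2)
    {M : Type*} [TopologicalSpace M] [ChartedSpace (EuclideanSpace ℝ (Fin n)) M]
    [IsManifold (𝓡 n) ∞ M]
    {N : Type*} [TopologicalSpace N] [ChartedSpace (EuclideanSpace ℝ (Fin (n + m))) N]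
    [IsManifold (𝓡 (n + m)) ∞ N]
    (g : Submanifold.RiemMetric n M) (g' : Submanifold.RiemMetric (n + m) N)
    (c : ℝ) (hc : Submanifold.IsRealSpaceForm g' c)
    (f : M → N) (hf : Submanifold.IsIsometricImmersion g g' f)
    (p : M) (e : Fin n → TangentSpace (𝓡 n) p) (he : Submanifold.IsTangentFrame g p e)
    (u : Fin m → TangentSpace (𝓡 (n + m)) (f p)) (hu : Submanifold.IsNormalFrame n g' f p u) :
    Submanifold.normScalarCurvature g p e ≤
      g'.inner (f p) (Submanifold.meanCurvature g g' f p e)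
          (Submanifold.meanCurvature g g' f p e) -
        Submanifold.normNormalScalarCurvature g g' f p e u + c := by

  classical
  set G := Submanifold.metricInChart g p with hG
  set G' := Submanifold.metricInChart g' (f p) with hG'
  set F := writtenInExtChartAt (𝓡 n) (𝓡 (n + m)) p f with hF
  set x := extChartAt (𝓡 n) p p with hxdef
  have hI := Submanifold.isIsometryOn_writtenInExtChartAt hf p
  rw [← hG, ← hG', ← hF] at hI
  have hx := Submanifold.extChartAt_mem_chartDomain (n := n) (k := n + m) f p
  rw [← hxdef] at hx
  have hFx : extChartAt (𝓡 (n + m)) (f p) (f p) = F x := by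
    simp [hF, hxdef, writtenInExtChartAt]
  have hGt : ∀ a b, g.inner p a b =
      G x (Submanifold.toChart n p a) (Submanifold.toChart n p b) := fun a b =>
    (Submanifold.metricInChart_toChart g p a b).symm
  have hGt' : ∀ a b, g'.inner (f p) a b =
      G' (F x) (Submanifold.toChart (n + m) (f p) a) (Submanifold.toChart (n + m) (f p) b) := by
    intro a b
    rw [← hFx]
    exact (Submanifold.metricInChart_toChart g' (f p) a b).symm
  have hS' := hI.metric'.symm (F x) (hI.mapsTo hx)
  set E : Fin n → EuclideanSpace ℝ (Fin n) := fun i => Submanifold.toChart n p (e i) with hE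
  set W : Fin m → EuclideanSpace ℝ (Fin (n + m)) :=
    fun α => Submanifold.toChart (n + m) (f p) (u α) with hW
  have hEE : ∀ i j, G x (E i) (E j) = if i = j then 1 else 0 := fun i j =>
    (hGt _ _).symm.trans (he i j)
  have hWW : ∀ α β, G' (F x) (W α) (W β) = if α = β then 1 else 0 := fun α β =>
    (hGt' _ _).symm.trans (hu.1 α β)
  have hWF : ∀ α z, G' (F x) (W α) (fderiv ℝ F x z) = 0 := by
    intro α z
    rw [← Submanifold.toChart_ofChart p z,
      Submanifold.fderiv_writtenInExtChartAt_toChart hf.contMDiff p, ← hGt']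
    exact hu.2 α _
  have hFW : ∀ α z, G' (F x) (fderiv ℝ F x z) (W α) = 0 := fun α z => by rw [hS', hWF]
  -- Every coordinate vector represents a tangent vector through `ofChart`, which preserves
  -- independence, so `hc` holds in the chart.
  have hcurv := hI.metric'.curvature_of_sectional (hI.mapsTo hx) (c := c) (by
    intro v w hvw
    have hli : LinearIndependent ℝ ![Submanifold.ofChart (n + m) (f p) v,
        Submanifold.ofChart (n + m) (f p) w] := by
      rw [LinearIndependent.pair_iff] at hvw ⊢
      intro s t hst
      have := congrArg (Submanifold.toChart (n + m) (f p)) hst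
      rw [map_add, map_smul, map_smul, Submanifold.toChart_ofChart, Submanifold.toChart_ofChart,
        map_zero] at this
      exact hvw s t this
    have := hc (f p) _ _ hli
    simpa only [Submanifold.sectionalCurvature, Submanifold.riemann, hGt',
      Submanifold.toChart_ofChart, hFx] using this)
  set σ := Submanifold.secondForm G G' F x with hσ
  set A : Fin m → Matrix (Fin n) (Fin n) ℝ := fun α i j => G' (F x) (σ (E i) (E j)) (W α) with hA
  have hparsE : ∀ a b, G x a b = ∑ k, G x a (E k) * G x b (E k) :=
    Submanifold.apply_eq_sum_of_orthonormal (G x) E hEE (by simp)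
  -- The vectors `dF(E i)` and `W α` are `n + m` orthonormal vectors in dimension `n + m`; for
  -- normal `X` only the `W α` contribute to Parseval's identity.
  have hpars : ∀ X Y, (∀ z, G' (F x) X (fderiv ℝ F x z) = 0) →
      G' (F x) X Y = ∑ α, G' (F x) X (W α) * G' (F x) Y (W α) := by
    intro X Y hX
    rw [Submanifold.apply_eq_sum_of_orthonormal (G' (F x))
      (Sum.elim (fun i => fderiv ℝ F x (E i)) W) ?_ (by simp) X Y]
    · simp [hX]
    · rintro (i | α) (j | β)
      · simp [hI.isometric x hx, hEE]
      · simp [hFW]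
      · simp [hWF]
      · simp [hWW]
  have hσn : ∀ a b z, G' (F x) (σ a b) (fderiv ℝ F x z) = 0 := hI.inner_secondForm_fderiv hx
  have hAsymm : ∀ α i j, A α i j = A α j i := fun α i j => by
    simp only [hA, hσ, hI.secondForm_symm hx (E i) (E j)]
  have hscal : ∀ i, ∀ j ∈ Finset.Ioi i,
      g.inner p (Submanifold.riemann g p (e i) (e j) (e j)) (e i) =
        c + ∑ α, (A α j j * A α i i - A α i j ^ 2) := by
    intro i j hij
    have hij' : i ≠ j := (Finset.mem_Ioi.1 hij).ne
    rw [hGt, Submanifold.riemann, Submanifold.toChart_ofChart]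
    change G x (Submanifold.curvature G x (E i) (E j) (E j)) (E i) = _
    rw [hI.gauss hx, hcurv, ← hσ, hpars _ _ (hσn _ _), hpars _ _ (hσn _ _)]
    simp only [hI.isometric x hx, hEE, if_true, if_neg hij', if_neg hij'.symm,
      Finset.sum_sub_distrib]
    have : ∀ α, G' (F x) (σ (E i) (E j)) (W α) * G' (F x) (σ (E j) (E i)) (W α) = A α i j ^ 2 := by
      intro α
      rw [sq]
      nth_rewrite 2 [hAsymm]
      rfl
    simp only [this]
    change c * (1 * 1 - 0 * 0) + (∑ α, A α j j * A α i i - ∑ α, A α i j ^ 2) =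
      c + (∑ α, A α j j * A α i i - ∑ α, A α i j ^ 2)
    ring
  have hmean : g'.inner (f p) (Submanifold.meanCurvature g g' f p e)
      (Submanifold.meanCurvature g g' f p e) = ∑ α, (1 / (n : ℝ) * ∑ i, A α i i) ^ 2 := by
    have h1 : Submanifold.toChart (n + m) (f p) (Submanifold.meanCurvature g g' f p e) =
        (1 / (n : ℝ)) • ∑ i, σ (E i) (E i) := by
      rw [Submanifold.meanCurvature, map_smul, map_sum]
      simp only [Submanifold.secondFundamentalForm, Submanifold.toChart_ofChart]
      rfl
    rw [hGt', h1, hpars]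
    · refine Finset.sum_congr rfl fun α _ => ?_
      simp [hA, sq]
    · intro z
      simp [hσn]
  have hnormal : ∀ i j α β,
      g'.inner (f p) (Submanifold.normalRiemann g g' f p (e i) (e j) (u α)) (u β) =
        ∑ k, (A α j k * A β i k - A α i k * A β j k) := by
    intro i j α β
    rw [hGt', Submanifold.normalRiemann, Submanifold.toChart_ofChart]
    change G' (F x) (Submanifold.normalCurvature G G' F x (E i) (E j) (W α)) (W β) = _
    -- The ambient term vanishes: in constant curvature it only contains products of a tangent
    -- vector with `W α`.
    rw [hI.ricci hx E hparsE _ _ _ _ (hWF α) (hWF β), hcurv]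
    simp only [hFW, ← hσ, hS' (W _), hA]
    simp
  rw [Submanifold.normScalarCurvature, Submanifold.normNormalScalarCurvature, hmean]
  simp only [hnormal]
  rw [Finset.sum_congr rfl fun i _ => Finset.sum_congr rfl (hscal i)]
  exact Submanifold.normal_scalar_inequality hn hmat A hAsymm c
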